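/- An entire function $E$ with $|E(z)|>|E(\overline z)|$ for all $z$ in the upper half plane $\mathbb C^+$ is called a de Branges function. Its de Branges space $\mathcal H(E)$ is the Hilbert space of entire functions $f$ such that $f/E$ and $f^*/E$ belong to the Hardy space $H^2(\mathbb C^+)$, where $f^*(z)=\overline{f(\overline z)}$, and $\|f\|_{\mathcal H(E)}^2=\int_{\mathbb R}|f/E|^2\,dx<\infty$. Let $E$ be a de Branges function and let $\mathcal N$ be a norm-closed linear subspace of $\mathcal H(E)$. Assume that the functions in $\mathcal N$ have no common zeros in $\mathbb C$ and that $\mathcal N$ is nearly invariant: whenever $f\in\mathcal N$, $\lambda\in\mathbb C$ and $f(\lambda)=0$, the function $f(z)/(z-\lambda)$ belongs to $\mathcal N$. Then there are $\alpha\in\mathbb R$ and a de Branges function $E_0$ such that $$\mathcal N=e^{i\alpha z}\mathcal H(E_0)=\{e^{i\alpha z}f(z): f\in\mathcal H(E_0)\},$$ and $\|e^{i\alpha z}f\|_{\mathcal H(E)}=\|f\|_{\mathcal H(E_0)}$ for every $f\in\mathcal H(E_0)$. -/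

import Mathlib

open MeasureTheory
open scoped ENNReal NNReal ComplexConjugate

/-- A de Branges function: an entire function `E` with `|E(z)| > |E(conj z)|` whenever
`Im z > 0`. -/
structure DeBrangesFunction where
  /-- The underlying function. -/
  toFun : ℂ → ℂ
  entire : Differentiable ℂ toFun
  norm_conj_lt : ∀ z : ℂ, 0 < z.im → ‖toFun (conj z)‖ < ‖toFun z‖

instance : CoeFun DeBrangesFunction (fun _ => ℂ → ℂ) := ⟨DeBrangesFunction.toFun⟩

/-- `f^*(z) = conj (f (conj z))`. -/
def conjReflect (f : ℂ → ℂ) : ℂ → ℂ := fun z => conj (f (conj z))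

/-- `g` belongs to the Hardy space `H²` of the upper half plane: `g` is analytic there and its
`L²` norms over the horizontal lines `Im z = y`, `y > 0`, are bounded uniformly in `y`. -/
def IsHardyTwo (g : ℂ → ℂ) : Prop :=
  DifferentiableOn ℂ g {z : ℂ | 0 < z.im} ∧
    ∃ C : ℝ≥0, ∀ y : ℝ, 0 < y → ∫⁻ x : ℝ, ‖g (x + y * Complex.I)‖ₑ ^ 2 ≤ C

/-- The three defining properties of the entire functions that form `H(E)`. -/
structure MemDeBranges (E : DeBrangesFunction) (f : ℂ → ℂ) : Prop where
  entire : Differentiable ℂ f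
  hardy : IsHardyTwo (fun z => f z / E z)
  hardy_conj : IsHardyTwo (fun z => conjReflect f z / E z)
  memLp : MemLp (fun x : ℝ => f x / E x) 2 volume

theorem IsHardyTwo.zero : IsHardyTwo (fun _ => 0) :=
  ⟨differentiableOn_const _, 0, fun y _ => by simp⟩

theorem IsHardyTwo.const_mul {g : ℂ → ℂ} (hg : IsHardyTwo g) (c : ℂ) :
    IsHardyTwo (fun z => c * g z) := by
  obtain ⟨hd, C, hC⟩ := hg
  refine ⟨hd.const_mul c, ‖c‖₊ ^ 2 * C, fun y hy => ?_⟩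
  simp only [enorm_mul, mul_pow]
  rw [lintegral_const_mul' _ _ (by simp)]
  push_cast
  gcongr
  · exact le_rfl
  · exact hC y hy

theorem IsHardyTwo.add {g h : ℂ → ℂ} (hg : IsHardyTwo g) (hh : IsHardyTwo h) :
    IsHardyTwo (fun z => g z + h z) := by
  obtain ⟨hgd, C, hC⟩ := hg
  obtain ⟨hhd, D, hD⟩ := hh
  refine ⟨hgd.add hhd, 2 * (C + D), fun y hy => ?_⟩
  have hcont : Continuous (fun x : ℝ => ‖g (x + y * Complex.I)‖ₑ ^ 2) := by
    have h1 : Continuous (fun x : ℝ => g (x + y * Complex.I)) := by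
      refine hgd.continuousOn.comp_continuous (by fun_prop) (fun x => ?_)
      simpa using hy
    exact (ENNReal.continuous_pow 2).comp h1.enorm
  calc ∫⁻ x : ℝ, ‖g (x + y * Complex.I) + h (x + y * Complex.I)‖ₑ ^ 2
      ≤ ∫⁻ x : ℝ, 2 * (‖g (x + y * Complex.I)‖ₑ ^ 2 + ‖h (x + y * Complex.I)‖ₑ ^ 2) := by
        refine lintegral_mono (fun x => ?_)
        refine (pow_le_pow_left' (enorm_add_le _ _) 2).trans ?_
        have := ENNReal.rpow_add_le_mul_rpow_add_rpow ‖g (x + y * Complex.I)‖ₑ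
          ‖h (x + y * Complex.I)‖ₑ (p := 2) (by norm_num)
        norm_num at this
        exact this
    _ = 2 * ((∫⁻ x : ℝ, ‖g (x + y * Complex.I)‖ₑ ^ 2)
          + (∫⁻ x : ℝ, ‖h (x + y * Complex.I)‖ₑ ^ 2)) := by
        rw [lintegral_const_mul' _ _ (by simp), lintegral_add_left hcont.measurable]
    _ ≤ ((2 * (C + D) : ℝ≥0) : ℝ≥0∞) := by
        push_cast
        gcongr
        · exact hC y hy
        · exact hD y hy

/-- The vector space of entire functions underlying `H(E)`. -/
def deBrangesSubmodule (E : DeBrangesFunction) : Submodule ℂ (ℂ → ℂ) where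
  carrier := {f | MemDeBranges E f}
  zero_mem' := by
    refine ⟨differentiable_const 0, ?_, ?_, ?_⟩
    · simpa using IsHardyTwo.zero
    · simpa [conjReflect] using IsHardyTwo.zero
    · simp
  add_mem' := by
    intro f g hf hg
    refine ⟨hf.entire.add hg.entire, ?_, ?_, ?_⟩
    · simpa [add_div] using hf.hardy.add hg.hardy
    · simpa [conjReflect, add_div] using hf.hardy_conj.add hg.hardy_conj
    · have := hf.memLp.add hg.memLp
      simpa [Pi.add_def, add_div] using this
  smul_mem' := by
    intro c f hf
    refine ⟨hf.entire.const_smul c, ?_, ?_, ?_⟩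
    · simpa [mul_div_assoc] using hf.hardy.const_mul c
    · simpa [conjReflect, mul_div_assoc] using hf.hardy_conj.const_mul (conj c)
    · simpa [mul_div_assoc] using hf.memLp.const_mul c

/-- The de Branges space `H(E)`. It is a type of its own, so that it carries the norm defined
below and not the topology of pointwise convergence. -/
def DeBrangesSpace (E : DeBrangesFunction) : Type := ↥(deBrangesSubmodule E)

namespace DeBrangesSpace

variable {E : DeBrangesFunction}

noncomputable instance : AddCommGroup (DeBrangesSpace E) :=
  inferInstanceAs (AddCommGroup ↥(deBrangesSubmodule E))

noncomputable instance : Module ℂ (DeBrangesSpace E) :=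
  inferInstanceAs (Module ℂ ↥(deBrangesSubmodule E))

/-- An element of `H(E)` is a function on `ℂ`. -/
instance : FunLike (DeBrangesSpace E) ℂ ℂ where
  coe := Subtype.val
  coe_injective := Subtype.val_injective

theorem mem (f : DeBrangesSpace E) : MemDeBranges E f := f.2

@[ext] theorem ext {f g : DeBrangesSpace E} (h : ∀ z, f z = g z) : f = g :=
  DFunLike.ext _ _ h

@[simp] theorem add_apply (f g : DeBrangesSpace E) (z : ℂ) : (f + g) z = f z + g z := rfl

@[simp] theorem smul_apply (c : ℂ) (f : DeBrangesSpace E) (z : ℂ) : (c • f) z = c * f z := rfl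

/-- The map `f ↦ f/E` from `H(E)` to `L²(ℝ)`. -/
noncomputable def toL2 (E : DeBrangesFunction) :
    DeBrangesSpace E →ₗ[ℂ] Lp ℂ 2 (volume : Measure ℝ) where
  toFun f := f.mem.memLp.toLp _
  map_add' f g := by
    rw [← MemLp.toLp_add]
    refine MemLp.toLp_congr _ _ (Filter.Eventually.of_forall fun x => ?_)
    simp [add_div]
  map_smul' c f := by
    rw [RingHom.id_apply, ← MemLp.toLp_const_smul]
    refine MemLp.toLp_congr _ _ (Filter.Eventually.of_forall fun x => ?_)
    simp [mul_div_assoc]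

theorem toL2_injective (E : DeBrangesFunction) : Function.Injective (toL2 E) := by
  refine (injective_iff_map_eq_zero _).2 (fun f hf => ?_)
  have h0 : (fun x : ℝ => f x / E x) =ᵐ[volume] 0 := by
    have h1 := f.mem.memLp.coeFn_toLp
    have h2 : (toL2 E f : ℝ → ℂ) =ᵐ[volume] 0 := by
      rw [hf]; exact Lp.coeFn_zero ℂ 2 volume
    exact h1.symm.trans h2
  have hcf : Continuous (fun x : ℝ => f x * E x) :=
    (f.mem.entire.continuous.comp Complex.continuous_ofReal).mul
      (E.entire.continuous.comp Complex.continuous_ofReal)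
  have h3 : (fun x : ℝ => f x * E x) =ᵐ[volume] fun _ => 0 := by
    filter_upwards [h0] with x hx
    rcases div_eq_zero_iff.1 (show f x / E x = 0 from hx) with h | h <;> simp [h]
  have h4 : (fun x : ℝ => f x * E x) = fun _ => 0 :=
    (hcf.ae_eq_iff_eq volume continuous_const).1 h3
  have hd : Differentiable ℂ (fun z => f z * E z) := f.mem.entire.mul E.entire
  have h5 : (fun z => f z * E z) = fun _ => 0 := by
    refine (hd.differentiableOn.analyticOnNhd isOpen_univ).eq_of_frequently_eq
      (g := fun _ => 0) (z₀ := 0) analyticOnNhd_const ?_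
    have ht : Filter.Tendsto (fun x : ℝ => (x : ℂ)) (nhdsWithin 0 {0}ᶜ)
        (nhdsWithin 0 {0}ᶜ) := by
      refine tendsto_nhdsWithin_iff.2 ⟨?_, ?_⟩
      · exact (Complex.continuous_ofReal.tendsto' 0 0 (by simp)).mono_left nhdsWithin_le_nhds
      · filter_upwards [self_mem_nhdsWithin] with x hx
        simpa using hx
    exact ht.frequently (Filter.Eventually.frequently
      (Filter.Eventually.of_forall fun x => congrFun h4 x))
  have hE : ∀ z : ℂ, 0 < z.im → f z = 0 := by
    intro z hz
    have hne : E z ≠ 0 := norm_pos_iff.1 ((norm_nonneg _).trans_lt (E.norm_conj_lt z hz))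
    exact (mul_eq_zero.1 (congrFun h5 z)).resolve_right hne
  have h6 : (f : ℂ → ℂ) = fun _ => 0 := by
    refine (f.mem.entire.differentiableOn.analyticOnNhd isOpen_univ).eq_of_eventuallyEq
      (g := fun _ => 0) (z₀ := Complex.I) analyticOnNhd_const ?_
    filter_upwards [(isOpen_lt continuous_const Complex.continuous_im).mem_nhds
      (show (0 : ℝ) < Complex.I.im by simp)] with z hz
    exact hE z hz
  exact DFunLike.coe_injective h6

/-- The norm of `H(E)` is the norm of `f/E` in `L²(ℝ)`. -/
noncomputable instance : NormedAddCommGroup (DeBrangesSpace E) :=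
  NormedAddCommGroup.induced _ _ (toL2 E) (toL2_injective E)

theorem norm_eq (f : DeBrangesSpace E) : ‖f‖ = ‖toL2 E f‖ := rfl

noncomputable instance : InnerProductSpace ℂ (DeBrangesSpace E) where
  norm_smul_le c f := by rw [norm_eq, norm_eq, map_smul]; exact norm_smul_le c _
  inner f g := inner ℂ (toL2 E f) (toL2 E g)
  norm_sq_eq_re_inner f := norm_sq_eq_re_inner (𝕜 := ℂ) (toL2 E f)
  conj_inner_symm f g := inner_conj_symm (toL2 E f) (toL2 E g)
  add_left f g h := by
    change inner ℂ (toL2 E (f + g)) (toL2 E h) = _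
    rw [map_add]; exact inner_add_left _ _ _
  smul_left f g c := by
    change inner ℂ (toL2 E (c • f)) (toL2 E g) = _
    rw [map_smul]; exact inner_smul_left _ _ _

/-- The formula for the norm: `‖f‖² = ∫_ℝ |f/E|² dx`. -/
theorem norm_sq_eq_integral (f : DeBrangesSpace E) :
    ‖f‖ ^ 2 = ∫ x : ℝ, ‖f x / E x‖ ^ 2 := by
  rw [norm_eq, norm_sq_eq_re_inner (𝕜 := ℂ), L2.inner_def]
  have h : (∫ a : ℝ, inner ℂ ((toL2 E f : ℝ → ℂ) a) ((toL2 E f : ℝ → ℂ) a))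
      = ∫ x : ℝ, ((‖f x / E x‖ ^ 2 : ℝ) : ℂ) := by
    refine integral_congr_ae ?_
    filter_upwards [f.mem.memLp.coeFn_toLp] with x hx
    have hx' : (toL2 E f : ℝ → ℂ) x = f x / E x := hx
    rw [hx', inner_self_eq_norm_sq_to_K]
    push_cast
    rfl
  rw [h]
  exact (congrArg Complex.re (integral_ofReal (𝕜 := ℂ))).trans (Complex.ofReal_re _)

/-- `z₀` is a common zero of the functions in `N`. -/
def IsCommonZero (N : Submodule ℂ (DeBrangesSpace E)) (z₀ : ℂ) : Prop :=
  ∀ f ∈ N, f z₀ = 0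

/-- `N` is nearly invariant: zeros of functions in `N` that are not common zeros of `N` can be
divided out without leaving `N`. The value of the quotient at the zero is the one that makes it
entire, since the elements of `H(E)` are entire. -/
def NearlyInvariant (N : Submodule ℂ (DeBrangesSpace E)) : Prop :=
  ∀ f ∈ N, ∀ z₀ : ℂ, ¬ IsCommonZero N z₀ → f z₀ = 0 →
    ∃ g ∈ N, ∀ z : ℂ, z ≠ z₀ → g z = f z / (z - z₀)

end DeBrangesSpace

/-! A Hilbert space of entire functions is determined, with its norm, by its reproducing kernel, so
it suffices to compute the kernel `K w` of `N`. It exists because point evaluations on `H(E)` are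
bounded and `H(E)` is complete, and `K w w > 0` because there are no common zeros.

Near invariance makes multiplication by `(z - conj lam) / (z - lam)` an isometry from the functions
of `N` vanishing at `lam` onto those vanishing at `conj lam`. Comparing the kernels of these two
subspaces (`NearlyInvariant.kernel_identity`, with `lam = i`) gives `2i (conj w - z) K w z = A z
conj (A w) - B z conj (B w)`, where `A = (z + i) u`, `B = (z - i) v` and `u`, `v` lie in `N`.

Taking `w = conj z` gives `A A^* = B B^*`; taking `w = z` gives `|A|² - |B|² = 4 (Im z) K z z`.
Hence `A` has no zeros in the closed upper and `B` none in the closed lower half plane, and `θ = A /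
B^*` is entire, zero-free and unimodular on the line. In the upper half plane `θ` is the quotient of
the Hardy functions `u / E` and `v^* / E`, so its logarithmic derivative is controlled off the real
line and is constant by a Liouville argument (`exists_eq_mul_exp`): `θ = c exp(2iαz)`. Splitting
this exponential evenly, `E₀ = √π exp(-iαz) A` is a de Branges function whose kernel is `exp(-iαz)
conj(exp(-iαw)) K w z`. Equality of Gram matrices of kernels yields the isometry
(`exists_of_inner_eq`).

The remaining analysis is Hardy space theory: the Cauchy formula gives the reproducing property in
`H(E₀)`, the Poisson formula the bounds on point evaluations. -/

/-! ### Pointwise growth of Hardy functions -/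

/-- The sub-mean value property of `|g|²` on circles. -/
theorem enorm_sq_le_lintegral_circle {g : ℂ → ℂ} {z : ℂ} {R ρ : ℝ}
    (hg : DifferentiableOn ℂ g (Metric.ball z R)) (hρ : 0 < ρ) (hR : ρ < R) :
    ENNReal.ofReal (2 * Real.pi) * ‖g z‖ₑ ^ 2 ≤
      ∫⁻ θ in Set.Ioo (-Real.pi) Real.pi, ‖g (z + Complex.polarCoord.symm (ρ, θ))‖ₑ ^ 2 := by
  have hd : DiffContOnCl ℂ (fun w => g w ^ 2) (Metric.ball z |ρ|) := by
    rw [abs_of_pos hρ]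
    refine DifferentiableOn.diffContOnCl ?_
    rw [closure_ball z hρ.ne']
    exact (hg.mono (Metric.closedBall_subset_ball hR)).pow 2
  have h1 := hd.circleAverage
  rw [Real.circleAverage_eq_integral_add (-Real.pi),
    intervalIntegral.integral_comp_add_right (fun θ => g (circleMap z ρ θ) ^ 2)] at h1
  have h2 : (2 * Real.pi : ℝ) • (g z) ^ 2 =
      ∫ θ in (-Real.pi)..Real.pi, g (circleMap z ρ θ) ^ 2 := by
    rw [← h1, smul_smul, mul_inv_cancel₀ (by positivity), one_smul]
    congr 1 <;> ring
  have h3 : ENNReal.ofReal (2 * Real.pi) * ‖g z‖ₑ ^ 2 = ‖(2 * Real.pi : ℝ) • (g z) ^ 2‖ₑ := by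
    rw [enorm_smul, enorm_pow, Real.enorm_eq_ofReal (by positivity)]
  rw [h3, h2, intervalIntegral.integral_of_le (by linarith [Real.pi_pos]),
    integral_Ioc_eq_integral_Ioo]
  refine (enorm_integral_le_lintegral_enorm _).trans (le_of_eq ?_)
  refine lintegral_congr fun θ => ?_
  rw [enorm_pow]
  congr 3
  simp [circleMap, Complex.exp_mul_I]

theorem lintegral_complex_eq {F : ℂ → ℝ≥0∞} (hF : Measurable F) :
    ∫⁻ z, F z = ∫⁻ y : ℝ, ∫⁻ x : ℝ, F (x + y * Complex.I) := by
  rw [← Complex.volume_preserving_equiv_real_prod.symm.lintegral_comp_emb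
    Complex.measurableEquivRealProd.symm.measurableEmbedding, Measure.volume_eq_prod,
    lintegral_prod_symm]
  · refine lintegral_congr fun y => lintegral_congr fun x => ?_
    congr 1
    apply Complex.ext <;> simp [Complex.measurableEquivRealProd_symm_apply]
  · exact (hF.comp Complex.measurableEquivRealProd.symm.measurable).aemeasurable

/-- Functions in the Hardy space are `O((Im z)^(-1/2))`. -/
theorem IsHardyTwo.exists_norm_le {g : ℂ → ℂ} (hg : IsHardyTwo g) :
    ∃ C : ℝ, 0 ≤ C ∧ ∀ z : ℂ, 0 < z.im → ‖g z‖ ≤ C / Real.sqrt z.im := by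
  obtain ⟨hd, C, hC⟩ := hg
  -- The integral of `|g|²` over the disc of radius `r = Im z / 2` is at most `2 r C` by horizontal
  -- slicing and at least `(π r² / 2) |g z|²` by circular means.
  refine ⟨Real.sqrt (8 * C), by positivity, fun z hz => ?_⟩
  set r := z.im / 2 with hr
  have hr0 : 0 < r := by positivity
  have hball : ∀ w ∈ Metric.ball z r, |w.im - z.im| < r := fun w hw => by
    rw [← Complex.sub_im]
    exact (Complex.abs_im_le_norm _).trans_lt (by simpa [dist_eq_norm] using hw)
  have hsub : Metric.ball z r ⊆ {z : ℂ | 0 < z.im} := fun w hw => by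
    have := abs_lt.1 (hball w hw)
    simp only [Set.mem_ofPred_eq]
    linarith
  have hdb := hd.mono hsub
  classical
  set F : ℂ → ℝ≥0∞ := (Metric.ball z r).indicator (fun w => ‖g w‖ₑ ^ 2) with hF
  have hFm : Measurable F := by
    rw [hF, ← Set.piecewise_eq_indicator]
    refine ContinuousOn.measurable_piecewise ?_ continuousOn_const Metric.isOpen_ball.measurableSet
    exact (ENNReal.continuous_pow 2).comp_continuousOn hdb.continuousOn.enorm
  have hup : ∫⁻ w, F w ≤ C * ENNReal.ofReal (2 * r) := by
    rw [lintegral_complex_eq hFm]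
    calc ∫⁻ y : ℝ, ∫⁻ x : ℝ, F (x + y * Complex.I)
        ≤ ∫⁻ y : ℝ, (Set.Ioo (z.im - r) (z.im + r)).indicator (fun _ => (C : ℝ≥0∞)) y := by
          refine lintegral_mono fun y => ?_
          by_cases hy : y ∈ Set.Ioo (z.im - r) (z.im + r)
          · rw [Set.indicator_of_mem hy]
            refine le_trans (lintegral_mono fun x => ?_) (hC y (by linarith [hy.1]))
            exact Set.indicator_le_self _ _ _
          · rw [Set.indicator_of_notMem hy]
            refine le_of_eq ((lintegral_congr fun x => ?_).trans lintegral_zero)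
            refine Set.indicator_of_notMem (fun hm => hy ?_) _
            have := abs_lt.1 (hball _ hm)
            simp only [Complex.add_im, Complex.ofReal_im, Complex.mul_im, Complex.ofReal_re,
              Complex.I_im, Complex.I_re] at this
            constructor <;> linarith
      _ = C * ENNReal.ofReal (2 * r) := by
          rw [lintegral_indicator measurableSet_Ioo, setLIntegral_const, Real.volume_Ioo]
          congr 2; ring
  -- Only the annulus `r / 2 < ρ < r` is kept: its width and the lower bound for the polar weight
  -- `ρ` are both `r / 2`.
  have hlow : ENNReal.ofReal (r / 2) * (ENNReal.ofReal (r / 2) *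
      (ENNReal.ofReal (2 * Real.pi) * ‖g z‖ₑ ^ 2)) ≤ ∫⁻ w, F w := by
    have hme : Measurable fun p : ℝ × ℝ =>
        ENNReal.ofReal p.1 • F (z + Complex.polarCoord.symm p) := by
      have : Continuous fun p : ℝ × ℝ => z + Complex.polarCoord.symm p := by
        simp only [Complex.polarCoord_symm_apply]
        fun_prop
      simp only [smul_eq_mul]
      exact (ENNReal.measurable_ofReal.comp measurable_fst).mul (hFm.comp this.measurable)
    rw [← lintegral_add_left_eq_self F z, ← Complex.lintegral_comp_polarCoord_symm,
      polarCoord_target, Measure.volume_eq_prod, ← Measure.prod_restrict,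
      lintegral_prod _ hme.aemeasurable]
    calc ENNReal.ofReal (r / 2) * (ENNReal.ofReal (r / 2) *
      (ENNReal.ofReal (2 * Real.pi) * ‖g z‖ₑ ^ 2))
        = ∫⁻ ρ in Set.Ioo (r / 2) r, ENNReal.ofReal (r / 2) *
            (ENNReal.ofReal (2 * Real.pi) * ‖g z‖ₑ ^ 2) := by
          rw [setLIntegral_const, Real.volume_Ioo, mul_comm]
          congr 2; ring
      _ ≤ ∫⁻ ρ in Set.Ioo (r / 2) r, ∫⁻ θ in Set.Ioo (-Real.pi) Real.pi,
            ENNReal.ofReal ρ • F (z + Complex.polarCoord.symm (ρ, θ)) := by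
          refine setLIntegral_mono' measurableSet_Ioo fun ρ hρ => ?_
          have hρ0 : 0 < ρ := by linarith [hρ.1]
          simp only [smul_eq_mul]
          rw [lintegral_const_mul' _ _ (by simp)]
          gcongr
          · exact hρ.1.le
          · refine (enorm_sq_le_lintegral_circle hdb hρ0 hρ.2).trans (le_of_eq ?_)
            refine lintegral_congr fun θ => ?_
            rw [hF, Set.indicator_of_mem]
            have := Complex.norm_polarCoord_symm (ρ, θ)
            simp only [Metric.mem_ball, dist_eq_norm, add_sub_cancel_left, this, abs_of_pos hρ0]
            exact hρ.2
      _ ≤ _ := lintegral_mono_set fun ρ hρ => lt_trans (by positivity) hρ.1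
  have h := hlow.trans hup
  rw [← ofReal_norm, ← ENNReal.ofReal_pow (norm_nonneg _),
    ← ENNReal.ofReal_mul (by positivity), ← ENNReal.ofReal_mul (by positivity),
    ← ENNReal.ofReal_mul (by positivity), ← ENNReal.ofReal_coe_nnreal,
    ← ENNReal.ofReal_mul (by positivity), ENNReal.ofReal_le_ofReal_iff (by positivity)] at h
  rw [← Real.sqrt_div (by positivity)]
  refine Real.le_sqrt_of_sq_le ?_
  rw [le_div_iff₀ hz]
  have h4 : r * (‖g z‖ ^ 2 * z.im) ≤ r * (8 * C) := by
    have : z.im = 2 * r := by rw [hr]; ring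
    rw [this]
    have hpi := Real.pi_gt_three
    have h0 : 0 ≤ r * r * ‖g z‖ ^ 2 := by positivity
    nlinarith
  exact le_of_mul_le_mul_left h4 hr0

/-! ### Contour shift, Cauchy and Poisson formulas -/

/-- The singularity `y^(-1/2)` is integrable at the real line; this handles the vertical sides of
the contour. -/
theorem norm_integral_inv_sqrt_le {f : ℝ → ℂ} {R D : ℝ} (hR : 0 ≤ R)
    (hf : ∀ y : ℝ, 0 < y → y ≤ R → ‖f y‖ ≤ D / Real.sqrt y) :
    ‖∫ y in (0 : ℝ)..R, f y‖ ≤ 2 * D * Real.sqrt R := by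
  have hii : IntervalIntegrable (fun y : ℝ => D * y ^ (-(1 / 2) : ℝ)) volume 0 R :=
    (intervalIntegral.intervalIntegrable_rpow' (by norm_num)).const_mul D
  refine (intervalIntegral.norm_integral_le_of_norm_le hR
    (Filter.Eventually.of_forall fun y hy => ?_) hii).trans (le_of_eq ?_)
  · rw [Real.rpow_neg hy.1.le, ← Real.sqrt_eq_rpow, ← div_eq_mul_inv]
    exact hf y hy.1 hy.2
  · rw [intervalIntegral.integral_const_mul, integral_rpow (Or.inl (by norm_num)),
      Real.sqrt_eq_rpow]
    norm_num
    ring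

/-- A contour shift: the integral along the real line of a function analytic in the upper half
plane that decays suitably vanishes. -/
theorem integral_eq_zero_of_norm_le {F : ℂ → ℂ} {C ρ : ℝ}
    (hc : ContinuousOn F {z : ℂ | 0 ≤ z.im}) (hd : DifferentiableOn ℂ F {z : ℂ | 0 < z.im})
    (hb : ∀ z : ℂ, 0 < z.im → ρ ≤ ‖z‖ → ‖F z‖ ≤ C / (Real.sqrt z.im * ‖z‖))
    (hi : Integrable (fun x : ℝ => F x)) : ∫ x : ℝ, F x = 0 := by
  have hlim : Filter.Tendsto (fun R : ℝ => ∫ x in (-R)..R, F x) Filter.atTop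
      (nhds (∫ x : ℝ, F x)) :=
    intervalIntegral_tendsto_integral hi Filter.tendsto_neg_atTop_atBot Filter.tendsto_id
  refine tendsto_nhds_unique hlim ?_
  -- On the rectangle with corners `-R` and `R + iR`, the top and the two vertical sides contribute
  -- at most `2C / √R` each.
  have hzero : Filter.Tendsto (fun R : ℝ => 6 * C / Real.sqrt R) Filter.atTop (nhds 0) :=
    Real.tendsto_sqrt_atTop.const_div_atTop _
  refine squeeze_zero_norm' ?_ hzero
  filter_upwards [Filter.eventually_ge_atTop (max ρ 1)] with R hR
  have hRρ : ρ ≤ R := (le_max_left _ _).trans hR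
  have hR0 : 0 < R := lt_of_lt_of_le one_pos ((le_max_right _ _).trans hR)
  have hsR : 0 < Real.sqrt R := Real.sqrt_pos.2 hR0
  have hss : Real.sqrt R * Real.sqrt R = R := Real.mul_self_sqrt hR0.le
  have hC : 0 ≤ C := by
    have h := (norm_nonneg _).trans (hb (R * Complex.I) (by simpa) (by simpa [abs_of_pos hR0]))
    by_contra hneg
    have : 0 < Real.sqrt (R * Complex.I).im * ‖(R : ℂ) * Complex.I‖ := by
      simp [abs_of_pos hR0, hR0]
    exact absurd h (not_le.2 (div_neg_of_neg_of_pos (not_le.1 hneg) this))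
  have hrect := Complex.integral_boundary_rect_eq_zero_of_continuousOn_of_differentiableOn F
    (-R : ℂ) (R + R * Complex.I) ?_ ?_
  rotate_left
  · refine hc.mono fun z hz => ?_
    have := hz.2
    simp [Set.uIcc_of_le hR0.le] at this
    exact this.1
  · refine hd.mono fun z hz => ?_
    have := hz.2
    simp [hR0.le] at this
    exact this.1
  simp only [Complex.neg_re, Complex.ofReal_re, Complex.neg_im, Complex.ofReal_im, neg_zero,
    Complex.add_re, Complex.mul_re, Complex.I_re, mul_zero, Complex.I_im, mul_one, sub_zero,
    add_zero, Complex.add_im, Complex.mul_im, zero_add, Complex.ofReal_zero, zero_mul,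
    smul_eq_mul] at hrect
  have htop : ‖∫ x in (-R)..R, F (x + R * Complex.I)‖ ≤ 2 * C / Real.sqrt R := by
    refine (intervalIntegral.norm_integral_le_of_norm_le_const
      (C := C / (Real.sqrt R * R)) fun x _ => ?_).trans (le_of_eq ?_)
    · have him : ((x : ℂ) + R * Complex.I).im = R := by simp
      have hn : R ≤ ‖(x : ℂ) + R * Complex.I‖ := by
        conv_lhs => rw [← him]
        exact (le_abs_self _).trans (Complex.abs_im_le_norm _)
      refine (hb _ (by rw [him]; exact hR0) (hRρ.trans hn)).trans ?_
      rw [him]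
      gcongr
    · rw [show R - -R = 2 * R by ring, abs_of_pos (by positivity)]
      field_simp
  have hside : ∀ s : ℝ, |s| = R →
      ‖∫ y in (0 : ℝ)..R, F ((s : ℂ) + y * Complex.I)‖ ≤ 2 * C / Real.sqrt R := by
    intro s hs
    refine (norm_integral_inv_sqrt_le (D := C / R) hR0.le fun y hy _ => ?_).trans (le_of_eq ?_)
    · have him : ((s : ℂ) + y * Complex.I).im = y := by simp
      have hn : R ≤ ‖(s : ℂ) + y * Complex.I‖ := by
        have : ((s : ℂ) + y * Complex.I).re = s := by simp
        calc R = |((s : ℂ) + y * Complex.I).re| := by rw [this, hs]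
          _ ≤ _ := Complex.abs_re_le_norm _
      refine (hb _ (by rw [him]; exact hy) (hRρ.trans hn)).trans ?_
      rw [him, div_div, mul_comm R]
      gcongr
    · conv_rhs => rw [div_eq_mul_inv]
      have : (Real.sqrt R)⁻¹ = Real.sqrt R / R := by
        field_simp
        rw [sq, hss]
      rw [this]; ring
  have h1 := hside R (abs_of_pos hR0)
  have h2 := hside (-R) (by rw [abs_neg, abs_of_pos hR0])
  rw [Complex.ofReal_neg] at h2 hrect
  have h3 : ∫ x in (-R)..R, F x = (∫ x in (-R)..R, F (x + R * Complex.I))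
      - Complex.I * (∫ y in (0 : ℝ)..R, F ((R : ℂ) + y * Complex.I))
      + Complex.I * (∫ y in (0 : ℝ)..R, F (-(R : ℂ) + y * Complex.I)) := by
    linear_combination hrect
  rw [h3]
  refine (norm_add_le _ _).trans ?_
  refine (add_le_add_left (norm_sub_le _ _) _).trans ?_
  rw [norm_mul, norm_mul, Complex.norm_I, one_mul, one_mul]
  have : 6 * C / Real.sqrt R = 2 * C / Real.sqrt R + 2 * C / Real.sqrt R + 2 * C / Real.sqrt R := by
    ring
  linarith

theorem ofReal_sub_ne_zero {w : ℂ} (hw : w.im ≠ 0) (x : ℝ) : (x : ℂ) - w ≠ 0 := fun h => hw (by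
  have := congrArg Complex.im h
  simpa using this)

theorem norm_inv_ofReal_sub_sq (w : ℂ) (hw : w.im ≠ 0) (x : ℝ) :
    ‖((x : ℂ) - w)⁻¹‖ ^ 2 = (w.im ^ 2)⁻¹ * (1 + ((x - w.re) / w.im) ^ 2)⁻¹ := by
  rw [norm_inv, inv_pow, Complex.sq_norm, Complex.normSq_apply, ← mul_inv]
  congr 1
  simp
  field_simp
  ring

theorem integrable_norm_inv_ofReal_sub_sq (w : ℂ) (hw : w.im ≠ 0) :
    Integrable (fun x : ℝ => ‖((x : ℂ) - w)⁻¹‖ ^ 2) := by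
  simp_rw [norm_inv_ofReal_sub_sq w hw]
  exact ((integrable_inv_one_add_sq.comp_div hw).comp_sub_right w.re).const_mul _

theorem integral_norm_inv_ofReal_sub_sq (w : ℂ) (hw : w.im ≠ 0) :
    ∫ x : ℝ, ‖((x : ℂ) - w)⁻¹‖ ^ 2 = Real.pi / |w.im| := by
  simp_rw [norm_inv_ofReal_sub_sq w hw]
  rw [integral_const_mul, integral_sub_right_eq_self (fun x => (1 + (x / w.im) ^ 2)⁻¹),
    Measure.integral_comp_div (fun x => (1 + x ^ 2)⁻¹), integral_univ_inv_one_add_sq,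
    ← sq_abs, smul_eq_mul]
  have := abs_pos.2 hw
  field_simp

theorem continuous_inv_ofReal_sub (w : ℂ) (hw : w.im ≠ 0) :
    Continuous (fun x : ℝ => ((x : ℂ) - w)⁻¹) :=
  Continuous.inv₀ (by fun_prop) (ofReal_sub_ne_zero hw)

theorem memLp_inv_ofReal_sub (w : ℂ) (hw : w.im ≠ 0) :
    MemLp (fun x : ℝ => ((x : ℂ) - w)⁻¹) 2 volume :=
  (memLp_two_iff_integrable_sq_norm (continuous_inv_ofReal_sub w hw).aestronglyMeasurable).2
    (integrable_norm_inv_ofReal_sub_sq w hw)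

theorem half_norm_le_norm_sub {z w : ℂ} (h : 2 * ‖w‖ ≤ ‖z‖) : ‖z‖ / 2 ≤ ‖z - w‖ := by
  have := norm_sub_norm_le z w
  linarith

/-- With the pole in the lower half plane the integrand is analytic above the line, and the growth
bound on `g` supplies the decay for the contour shift. -/
theorem integral_div_sub_eq_zero {g : ℂ → ℂ} (hc : ContinuousOn g {z : ℂ | 0 ≤ z.im})
    (hg : IsHardyTwo g) (hL : MemLp (fun x : ℝ => g x) 2 volume) {w : ℂ} (hw : w.im < 0) :
    ∫ x : ℝ, g x / (x - w) = 0 := by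
  obtain ⟨C, hC0, hC⟩ := hg.exists_norm_le
  have hne : ∀ z : ℂ, 0 ≤ z.im → z - w ≠ 0 := fun z hz h => by
    rw [sub_eq_zero.1 h] at hz; linarith
  refine integral_eq_zero_of_norm_le (F := fun z => g z / (z - w)) (C := 2 * C)
    (ρ := max 1 (2 * ‖w‖)) (hc.div (by fun_prop) hne)
    (hg.1.div (by fun_prop) fun z hz => hne z (le_of_lt hz)) (fun z hz hzn => ?_) ?_
  · have h1 : 1 ≤ ‖z‖ := (le_max_left _ _).trans hzn
    have hs := Real.sqrt_pos.2 hz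
    rw [norm_div]
    calc ‖g z‖ / ‖z - w‖ ≤ (C / Real.sqrt z.im) / (‖z‖ / 2) := by
          gcongr
          · exact hC z hz
          · exact half_norm_le_norm_sub ((le_max_right _ _).trans hzn)
      _ = _ := by field_simp
  · simp_rw [div_eq_mul_inv]
    exact hL.integrable_mul (memLp_inv_ofReal_sub w hw.ne)

/-- The Cauchy formula in the Hardy space. -/
theorem integral_div_sub_eq {g : ℂ → ℂ} (hc : ContinuousOn g {z : ℂ | 0 ≤ z.im})
    (hg : IsHardyTwo g) (hL : MemLp (fun x : ℝ => g x) 2 volume) {w : ℂ} (hw : 0 < w.im) :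
    ∫ x : ℝ, g x / (x - w) = 2 * Real.pi * Complex.I * g w := by
  obtain ⟨C, hC0, hC⟩ := hg.exists_norm_le
  have hne : ∀ z : ℂ, 0 ≤ z.im → z - conj w ≠ 0 := fun z hz h => by
    rw [sub_eq_zero.1 h] at hz; simp at hz; linarith
  -- Subtracting `c / (z - conj w)` makes `g` vanish at `w`, so dividing by `z - w` leaves no pole.
  -- The correction integrates explicitly: `1 / ((x - w)(x - conj w)) = |x - w|⁻²` has integral `π /
  -- Im w`.
  set c : ℂ := g w * (w - conj w) with hcdef
  set h : ℂ → ℂ := fun z => g z - c / (z - conj w) with hh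
  have hhw : h w = 0 := by
    simp only [hh, hcdef]
    rw [mul_div_cancel_right₀ _ (hne w hw.le), sub_self]
  have hUo : IsOpen {z : ℂ | 0 < z.im} := isOpen_lt continuous_const Complex.continuous_im
  have hUn : {z : ℂ | 0 < z.im} ∈ nhds w := hUo.mem_nhds hw
  have hVn : {z : ℂ | 0 ≤ z.im} ∈ nhds w :=
    Filter.mem_of_superset hUn fun z hz => le_of_lt (show 0 < z.im from hz)
  have hhc : ContinuousOn h {z : ℂ | 0 ≤ z.im} :=
    hc.sub (continuousOn_const.div (by fun_prop) hne)
  have hhd : DifferentiableOn ℂ h {z : ℂ | 0 < z.im} :=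
    hg.1.sub ((differentiableOn_const _).div (by fun_prop) fun z hz => hne z (le_of_lt hz))
  have hwim : (conj w).im ≠ 0 := by simpa using hw.ne'
  have hval : ∀ x : ℝ, dslope h w x = g x / (x - w) - c * (((x : ℂ) - w)⁻¹ * (x - conj w)⁻¹) := by
    intro x
    have h1 := ofReal_sub_ne_zero hw.ne' x
    have h2 := ofReal_sub_ne_zero hwim x
    rw [dslope_of_ne _ (sub_ne_zero.1 h1), slope_def_field, hhw, sub_zero]
    simp only [hh]
    field_simp
  have hi1 : Integrable (fun x : ℝ => g x / (x - w)) := by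
    simp_rw [div_eq_mul_inv]
    exact hL.integrable_mul (memLp_inv_ofReal_sub w hw.ne')
  have hi2 : Integrable (fun x : ℝ => c * (((x : ℂ) - w)⁻¹ * ((x : ℂ) - conj w)⁻¹)) :=
    ((memLp_inv_ofReal_sub w hw.ne').integrable_mul (memLp_inv_ofReal_sub _ hwim)).const_mul c
  have key := integral_eq_zero_of_norm_le (F := dslope h w) (C := 2 * (C + 2 * ‖c‖))
    (ρ := max 1 (2 * ‖w‖ + 1)) ?_ ?_ ?_ ?_
  · simp_rw [hval] at key
    rw [integral_sub hi1 hi2, sub_eq_zero] at key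
    rw [key, integral_const_mul]
    have : ∀ x : ℝ, ((x : ℂ) - w)⁻¹ * ((x : ℂ) - conj w)⁻¹ = ((‖((x : ℂ) - w)⁻¹‖ ^ 2 : ℝ) : ℂ) := by
      intro x
      have hcj : ((x : ℂ) - conj w)⁻¹ = conj (((x : ℂ) - w)⁻¹) := by simp
      rw [hcj, Complex.mul_conj', Complex.ofReal_pow]
    simp_rw [this]
    have hcw : w - conj w = 2 * w.im * Complex.I := by
      rw [Complex.sub_conj]; push_cast; ring
    have hne' : (w.im : ℂ) ≠ 0 := by exact_mod_cast hw.ne'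
    rw [integral_complex_ofReal, integral_norm_inv_ofReal_sub_sq w hw.ne', abs_of_pos hw, hcdef, hcw]
    push_cast
    field_simp
  · exact (continuousOn_dslope hVn).2 ⟨hhc, hhd.differentiableAt hUn⟩
  · exact (Complex.differentiableOn_dslope hUn).2 hhd
  · intro z hz hzn
    have h1 : 1 ≤ ‖z‖ := (le_max_left _ _).trans hzn
    have h2 : 2 * ‖w‖ + 1 ≤ ‖z‖ := (le_max_right _ _).trans hzn
    have hs := Real.sqrt_pos.2 hz
    have hd1 : ‖z‖ / 2 ≤ ‖z - w‖ := half_norm_le_norm_sub (by linarith)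
    have hd2 : ‖z‖ / 2 ≤ ‖z - conj w‖ :=
      half_norm_le_norm_sub (by rw [Complex.norm_conj]; linarith)
    have hzw : z ≠ w := fun h => by
      rw [h] at h2
      linarith [norm_nonneg w]
    -- Since `‖z‖ ≥ 1`, the `1/|z|` decay of the correction is absorbed into the `1/√(Im z)` bound
    -- of `g`.
    have hsz : Real.sqrt z.im ≤ ‖z‖ := by
      refine Real.sqrt_le_iff.2 ⟨norm_nonneg _, ?_⟩
      have : z.im ≤ ‖z‖ := (le_abs_self _).trans (Complex.abs_im_le_norm z)
      nlinarith
    have hhz : ‖h z‖ ≤ (C + 2 * ‖c‖) / Real.sqrt z.im := by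
      refine (norm_sub_le _ _).trans ?_
      rw [add_div, norm_div]
      refine add_le_add (hC z hz) ?_
      calc ‖c‖ / ‖z - conj w‖ ≤ ‖c‖ / (Real.sqrt z.im / 2) := by
            gcongr
            linarith
        _ = _ := by field_simp
    rw [dslope_of_ne _ hzw, slope_def_field, hhw, sub_zero, norm_div]
    calc ‖h z‖ / ‖z - w‖ ≤ ((C + 2 * ‖c‖) / Real.sqrt z.im) / (‖z‖ / 2) := by gcongr
      _ = _ := by field_simp
  · simp_rw [hval]
    exact hi1.sub hi2

/-- The Poisson kernel is the difference of the Cauchy kernels at `w` and `conj w`, and the second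
one integrates to zero. -/
theorem integral_mul_poisson_eq {g : ℂ → ℂ} (hc : ContinuousOn g {z : ℂ | 0 ≤ z.im})
    (hg : IsHardyTwo g) (hL : MemLp (fun x : ℝ => g x) 2 volume) {w : ℂ} (hw : 0 < w.im) :
    ∫ x : ℝ, g x * (‖((x : ℂ) - w)⁻¹‖ ^ 2 : ℝ) = (Real.pi / w.im : ℝ) * g w := by
  have hwim : (conj w).im ≠ 0 := by simpa using hw.ne'
  have hcw : w - conj w = 2 * w.im * Complex.I := by
    rw [Complex.sub_conj]; push_cast; ring
  have hne' : (w.im : ℂ) ≠ 0 := by exact_mod_cast hw.ne'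
  have hsub : ∀ x : ℝ, g x * (‖((x : ℂ) - w)⁻¹‖ ^ 2 : ℝ) =
      (2 * w.im * Complex.I)⁻¹ * (g x / (x - w) - g x / (x - conj w)) := by
    intro x
    have h1 := ofReal_sub_ne_zero hw.ne' x
    have h2 := ofReal_sub_ne_zero hwim x
    have hcj : conj (((x : ℂ) - w)⁻¹) = ((x : ℂ) - conj w)⁻¹ := by simp
    rw [Complex.ofReal_pow, ← Complex.mul_conj', hcj, ← hcw]
    have h3 : w - conj w ≠ 0 := by rw [hcw]; simp [hne']
    field_simp
    ring
  simp_rw [hsub]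
  rw [integral_const_mul, integral_sub, integral_div_sub_eq hc hg hL hw,
    integral_div_sub_eq_zero hc hg hL (w := conj w) (by simpa using hw)]
  · push_cast
    have := Complex.I_ne_zero
    field_simp
    ring
  · simp_rw [div_eq_mul_inv]
    exact hL.integrable_mul (memLp_inv_ofReal_sub w hw.ne')
  · simp_rw [div_eq_mul_inv]
    exact hL.integrable_mul (memLp_inv_ofReal_sub _ hwim)

/-- Jensen's inequality for the Poisson integral of a function in the Hardy space. -/
theorem enorm_sq_le_lintegral_poisson {g : ℂ → ℂ} (hc : ContinuousOn g {z : ℂ | 0 ≤ z.im})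
    (hg : IsHardyTwo g) (hL : MemLp (fun x : ℝ => g x) 2 volume) {w : ℂ} (hw : 0 < w.im) :
    ‖g w‖ₑ ^ 2 ≤ ENNReal.ofReal (w.im / Real.pi) *
      ∫⁻ x : ℝ, ‖g x‖ₑ ^ 2 * ‖((x : ℂ) - w)⁻¹‖ₑ ^ 2 := by
  have hmul : ENNReal.ofReal (Real.pi / w.im) * ‖g w‖ₑ ≤
      ∫⁻ x : ℝ, (‖g x‖ₑ * ‖((x : ℂ) - w)⁻¹‖ₑ) * ‖((x : ℂ) - w)⁻¹‖ₑ := by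
    have h := congrArg (fun z : ℂ => ‖z‖ₑ) (integral_mul_poisson_eq hc hg hL hw)
    have hn : ‖((Real.pi / w.im : ℝ) : ℂ)‖ₑ = ENNReal.ofReal (Real.pi / w.im) := by
      rw [← ofReal_norm, Complex.norm_real, Real.norm_of_nonneg (by positivity)]
    simp only [enorm_mul, hn] at h
    rw [← h]
    refine (enorm_integral_le_lintegral_enorm _).trans (le_of_eq (lintegral_congr fun x => ?_))
    rw [enorm_mul, mul_assoc, ← sq]
    congr 1
    rw [← ofReal_norm, Complex.norm_real, Real.norm_of_nonneg (by positivity),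
      ENNReal.ofReal_pow (norm_nonneg _), ofReal_norm]
  have hgm : AEMeasurable (fun x : ℝ => ‖g x‖ₑ) := hL.1.enorm
  have him : AEMeasurable (fun x : ℝ => ‖((x : ℂ) - w)⁻¹‖ₑ) :=
    (memLp_inv_ofReal_sub w hw.ne').1.enorm
  have hP : ∫⁻ x : ℝ, ‖((x : ℂ) - w)⁻¹‖ₑ ^ 2 = ENNReal.ofReal (Real.pi / w.im) := by
    have := ofReal_integral_eq_lintegral_ofReal (integrable_norm_inv_ofReal_sub_sq w hw.ne')
      (Filter.Eventually.of_forall fun x => by positivity)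
    rw [integral_norm_inv_ofReal_sub_sq w hw.ne', abs_of_pos hw] at this
    rw [this]
    refine lintegral_congr fun x => ?_
    rw [ENNReal.ofReal_pow (norm_nonneg _), ofReal_norm]
  -- Cauchy–Schwarz with one factor `|x - w|⁻¹` of the kernel on each side.
  have hCS := ENNReal.lintegral_mul_le_Lp_mul_Lq volume Real.HolderConjugate.two_two
    (hgm.mul him) him
  simp only [Pi.mul_apply, ENNReal.rpow_two] at hCS
  have h1 := pow_le_pow_left' (hmul.trans hCS) 2
  rw [mul_pow, mul_pow, ← ENNReal.rpow_two, ← ENNReal.rpow_two, ← ENNReal.rpow_two (_ ^ (1 / 2 : ℝ)),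
    ← ENNReal.rpow_two (_ ^ (1 / 2 : ℝ)), ← ENNReal.rpow_mul, ← ENNReal.rpow_mul, hP] at h1
  norm_num at h1
  simp only [mul_pow] at h1
  set p := ENNReal.ofReal (Real.pi / w.im) with hp
  have hp0 : p ≠ 0 := by
    rw [hp]; simp only [ne_eq, ENNReal.ofReal_eq_zero, not_le]; positivity
  have hinv : ENNReal.ofReal (w.im / Real.pi) * p = 1 := by
    rw [hp, ← ENNReal.ofReal_mul (by positivity)]
    rw [show w.im / Real.pi * (Real.pi / w.im) = 1 by field_simp]
    simp
  rw [sq p, mul_assoc, mul_comm _ p] at h1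
  have h2 := (ENNReal.mul_le_mul_iff_right hp0 (by simp [hp])).1 h1
  calc ‖g w‖ₑ ^ 2 = ENNReal.ofReal (w.im / Real.pi) * (p * ‖g w‖ₑ ^ 2) := by
        rw [← mul_assoc, hinv, one_mul]
    _ ≤ _ := by gcongr

/-- The `L²` norms over horizontal lines are bounded by the norm of the boundary values. -/
theorem lintegral_line_le {g : ℂ → ℂ} (hc : ContinuousOn g {z : ℂ | 0 ≤ z.im})
    (hg : IsHardyTwo g) (hL : MemLp (fun x : ℝ => g x) 2 volume) {y : ℝ} (hy : 0 < y) :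
    ∫⁻ x : ℝ, ‖g (x + y * Complex.I)‖ₑ ^ 2 ≤ ∫⁻ x : ℝ, ‖g x‖ₑ ^ 2 := by
  have hgm : Measurable (fun x : ℝ => ‖g x‖ₑ ^ 2) := by
    have : Continuous (fun x : ℝ => g x) :=
      hc.comp_continuous (by fun_prop) (fun x => by simp)
    exact ((ENNReal.continuous_pow 2).comp this.enorm).measurable
  have hne : ∀ p : ℝ × ℝ, (p.2 : ℂ) - (p.1 + y * Complex.I) ≠ 0 := fun p h => hy.ne' (by
    have := congrArg Complex.im h
    simpa using this)
  have hcont : Continuous (fun p : ℝ × ℝ => ((p.2 : ℂ) - (p.1 + y * Complex.I))⁻¹) :=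
    Continuous.inv₀ (by fun_prop) hne
  -- The kernel has the same mass in `x` as in `t`, so Tonelli turns the pointwise Jensen bound into
  -- a contraction.
  have hker : ∀ t : ℝ, ∫⁻ x : ℝ, ‖((t : ℂ) - (x + y * Complex.I))⁻¹‖ₑ ^ 2 =
      ENNReal.ofReal (Real.pi / y) := by
    intro t
    have hwim : ((t : ℂ) - y * Complex.I).im ≠ 0 := by simpa using hy.ne'
    have := ofReal_integral_eq_lintegral_ofReal (integrable_norm_inv_ofReal_sub_sq _ hwim)
      (Filter.Eventually.of_forall fun x => by positivity)
    rw [integral_norm_inv_ofReal_sub_sq _ hwim] at this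
    simp only [Complex.sub_im, Complex.ofReal_im, Complex.mul_im, Complex.ofReal_re,
      Complex.I_im, mul_one, Complex.I_re, mul_zero, add_zero, zero_sub, abs_neg,
      abs_of_pos hy] at this
    rw [this]
    refine lintegral_congr fun x => ?_
    rw [ENNReal.ofReal_pow (norm_nonneg _), ofReal_norm, ← enorm_neg, ← inv_neg]
    congr 3
    ring
  calc ∫⁻ x : ℝ, ‖g (x + y * Complex.I)‖ₑ ^ 2
      ≤ ∫⁻ x : ℝ, ENNReal.ofReal (y / Real.pi) *
          ∫⁻ t : ℝ, ‖g t‖ₑ ^ 2 * ‖((t : ℂ) - (x + y * Complex.I))⁻¹‖ₑ ^ 2 := by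
        refine lintegral_mono fun x => ?_
        have him : ((x : ℂ) + y * Complex.I).im = y := by simp
        have := enorm_sq_le_lintegral_poisson hc hg hL (w := (x : ℂ) + y * Complex.I)
          (by rw [him]; exact hy)
        rwa [him] at this
    _ = ENNReal.ofReal (y / Real.pi) * ∫⁻ t : ℝ, ‖g t‖ₑ ^ 2 * ENNReal.ofReal (Real.pi / y) := by
        rw [lintegral_const_mul' _ _ ENNReal.ofReal_ne_top, lintegral_lintegral_swap]
        · congr 1
          refine lintegral_congr fun t => ?_
          rw [lintegral_const_mul' _ _ (by simp), hker]
        · refine Measurable.aemeasurable ?_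
          exact (hgm.comp measurable_snd).mul
            ((ENNReal.continuous_pow 2).comp hcont.enorm).measurable
    _ = ∫⁻ x : ℝ, ‖g x‖ₑ ^ 2 := by
        rw [lintegral_mul_const' _ _ ENNReal.ofReal_ne_top, mul_comm, mul_assoc,
          ← ENNReal.ofReal_mul (by positivity),
          show Real.pi / y * (y / Real.pi) = 1 by field_simp]
        simp

/-! ### Reflection, bounds degenerating at the line, limits of Hardy functions -/

theorem conjReflect_apply (f : ℂ → ℂ) (z : ℂ) : conjReflect f z = conj (f (conj z)) := rfl

theorem conjReflect_ofReal (f : ℂ → ℂ) (x : ℝ) : conjReflect f x = conj (f x) := by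
  simp [conjReflect]

theorem Differentiable.conjReflect {f : ℂ → ℂ} (hf : Differentiable ℂ f) :
    Differentiable ℂ (conjReflect f) := fun z => by
  have := (hf (conj z)).conj_conj
  rwa [Complex.conj_conj] at this

/-- A bound on a circle that degenerates at the real points gives a bound inside. -/
theorem norm_mul_pow_le_of_circle {f : ℂ → ℂ} (hf : Differentiable ℂ f) {ρ B : ℝ} (hρ : 0 < ρ)
    (n : ℕ) (h : ∀ z : ℂ, ‖z‖ = ρ → ‖f z‖ * (2 * ρ * |z.im|) ^ n ≤ B) {z : ℂ}
    (hz : ‖z‖ ≤ ρ / 2) : ‖f z‖ * (3 / 4 * ρ ^ 2) ^ n ≤ B := by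
  -- On `|z| = ρ` one has `ρ² = z conj z`, so `|z² - ρ²| = 2ρ |Im z|`; for `|z| ≤ ρ / 2` the factor
  -- is at least `3ρ² / 4`. The maximum principle connects the two.
  have hd : Differentiable ℂ (fun z => f z * (z ^ 2 - (ρ : ℂ) ^ 2) ^ n) := by fun_prop
  have hmax := Complex.norm_le_of_forall_mem_frontier_norm_le (U := Metric.ball 0 ρ) (C := B)
    Metric.isBounded_ball hd.diffContOnCl (fun w hw => ?_) (z := z) (subset_closure ?_)
  · refine le_trans ?_ hmax
    rw [norm_mul, norm_pow]
    gcongr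
    have h1 := norm_sub_norm_le ((ρ : ℂ) ^ 2) (z ^ 2)
    rw [norm_sub_rev, norm_pow, norm_pow, Complex.norm_real, Real.norm_of_nonneg hρ.le] at h1
    have h2 : ‖z‖ ^ 2 ≤ (ρ / 2) ^ 2 := by gcongr
    linarith
  · rw [frontier_ball _ hρ.ne'] at hw
    have hw' : ‖w‖ = ρ := by simpa using hw
    refine le_trans (le_of_eq ?_) (h w hw')
    have h3 : w ^ 2 - (ρ : ℂ) ^ 2 = w * (2 * w.im * Complex.I) := by
      have h4 : (ρ : ℂ) ^ 2 = w * conj w := by rw [Complex.mul_conj', hw']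
      have h5 : w - conj w = 2 * w.im * Complex.I := by rw [Complex.sub_conj]; push_cast; ring
      rw [h4, ← h5]; ring
    rw [norm_mul, norm_pow, h3]
    simp [hw']
    left
    ring
  · simp only [Metric.mem_ball, dist_zero_right]
    linarith

/-- Fatou's lemma on each horizontal line. -/
theorem isHardyTwo_of_tendsto {u : ℕ → ℂ → ℂ} {g : ℂ → ℂ} {C : ℝ≥0}
    (hu : ∀ n, ContinuousOn (u n) {z : ℂ | 0 < z.im})
    (hg : DifferentiableOn ℂ g {z : ℂ | 0 < z.im})
    (hlim : ∀ z : ℂ, 0 < z.im → Filter.Tendsto (fun n => u n z) Filter.atTop (nhds (g z)))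
    (hC : ∀ n, ∀ y : ℝ, 0 < y → ∫⁻ x : ℝ, ‖u n (x + y * Complex.I)‖ₑ ^ 2 ≤ C) :
    IsHardyTwo g := by
  refine ⟨hg, C, fun y hy => ?_⟩
  have him : ∀ x : ℝ, 0 < ((x : ℂ) + y * Complex.I).im := fun x => by simpa using hy
  calc ∫⁻ x : ℝ, ‖g (x + y * Complex.I)‖ₑ ^ 2
      = ∫⁻ x : ℝ, Filter.liminf (fun n => ‖u n (x + y * Complex.I)‖ₑ ^ 2) Filter.atTop := by
        refine lintegral_congr fun x => ?_
        refine (Filter.Tendsto.liminf_eq ?_).symm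
        exact ((ENNReal.continuous_pow 2).tendsto _).comp (hlim _ (him x)).enorm
    _ ≤ Filter.liminf (fun n => ∫⁻ x : ℝ, ‖u n (x + y * Complex.I)‖ₑ ^ 2) Filter.atTop := by
        refine lintegral_liminf_le fun n => ?_
        exact ((ENNReal.continuous_pow 2).comp
          ((hu n).comp_continuous (by fun_prop) him).enorm).measurable
    _ ≤ C := by
        refine Filter.liminf_le_of_frequently_le' ?_
        exact Filter.Frequently.of_forall fun n => hC n y hy

/-! ### Point evaluations and completeness of de Branges spaces -/

namespace DeBrangesFunction

theorem ne_zero_of_im_pos (E : DeBrangesFunction) {z : ℂ} (hz : 0 < z.im) : E z ≠ 0 :=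
  norm_pos_iff.1 ((norm_nonneg _).trans_lt (E.norm_conj_lt z hz))

theorem ne_zero_of_im_nonneg {E : DeBrangesFunction} (hE : ∀ x : ℝ, E x ≠ 0) {z : ℂ}
    (hz : 0 ≤ z.im) : E z ≠ 0 := by
  rcases hz.lt_or_eq with h | h
  · exact E.ne_zero_of_im_pos h
  · have : z = (z.re : ℝ) := Complex.ext (by simp) (by simp [← h])
    rw [this]
    exact hE _

theorem differentiableOn_div {E : DeBrangesFunction} {f : ℂ → ℂ} (hf : Differentiable ℂ f) :
    DifferentiableOn ℂ (fun z => f z / E z) {z : ℂ | 0 < z.im} :=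
  hf.differentiableOn.div E.entire.differentiableOn fun _ hz => E.ne_zero_of_im_pos hz

theorem continuousOn_div {E : DeBrangesFunction} (hE : ∀ x : ℝ, E x ≠ 0) {f : ℂ → ℂ}
    (hf : Differentiable ℂ f) : ContinuousOn (fun z => f z / E z) {z : ℂ | 0 ≤ z.im} :=
  hf.continuous.continuousOn.div E.entire.continuous.continuousOn
    fun _ hz => ne_zero_of_im_nonneg hE hz

end DeBrangesFunction

theorem MemDeBranges.memLp_conj {E : DeBrangesFunction} {f : ℂ → ℂ} (hf : MemDeBranges E f)
    (hE : ∀ x : ℝ, E x ≠ 0) : MemLp (fun x : ℝ => conjReflect f x / E x) 2 volume := by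
  refine hf.memLp.of_le ?_ (Filter.Eventually.of_forall fun x => ?_)
  · exact ((DeBrangesFunction.continuousOn_div hE hf.entire.conjReflect).comp_continuous
      Complex.continuous_ofReal (fun x => by simp)).aestronglyMeasurable
  · rw [conjReflect_ofReal, norm_div, norm_div, Complex.norm_conj]

/-- Functions in `H(E)` vanish at the real zeros of `E`. -/
theorem MemDeBranges.eq_zero_of_eq_zero {E : DeBrangesFunction} {f : ℂ → ℂ}
    (hf : MemDeBranges E f) {x₀ : ℝ} (h0 : E x₀ = 0) : f x₀ = 0 := by
  by_contra hne
  -- If `f x₀ ≠ 0`, then `|f / E|` dominates a multiple of `1 / |x - x₀|` near `x₀`, which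
  -- contradicts the local integrability of an `L²` function.
  have hii : IntervalIntegrable (fun x : ℝ => f x / E x) volume x₀ (x₀ + 1) := by
    rw [intervalIntegrable_iff]
    exact hf.memLp.locallyIntegrable (by norm_num) |>.integrableOn_isCompact
      isCompact_uIcc |>.mono_set Set.uIoc_subset_uIcc
  refine not_intervalIntegrable_of_sub_inv_isBigO_punctured ?_ (by simp) Set.left_mem_uIcc hii
  have hfc : Continuous fun x : ℝ => f x := hf.entire.continuous.comp Complex.continuous_ofReal
  have hEO : (fun x : ℝ => E x) =O[nhds x₀] fun x => x - x₀ := by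
    have h := ((E.entire x₀).hasDerivAt.comp_ofReal).differentiableAt.isBigO_sub
    simpa [h0] using h
  have hEne : ∀ᶠ x : ℝ in nhdsWithin x₀ {x₀}ᶜ, E x ≠ 0 := by
    have hA : AnalyticAt ℂ E.toFun x₀ := E.entire.analyticAt _
    have ht : Filter.Tendsto (fun x : ℝ => (x : ℂ)) (nhdsWithin x₀ {x₀}ᶜ)
        (nhdsWithin (x₀ : ℂ) {(x₀ : ℂ)}ᶜ) := by
      refine tendsto_nhdsWithin_iff.2 ⟨?_, ?_⟩
      · exact (Complex.continuous_ofReal.tendsto x₀).mono_left nhdsWithin_le_nhds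
      · filter_upwards [self_mem_nhdsWithin] with x hx
        simpa using hx
    rcases hA.eventually_eq_zero_or_eventually_ne_zero with h | h
    · exfalso
      have := (E.entire.differentiableOn.analyticOnNhd isOpen_univ).eq_of_eventuallyEq
        (g := fun _ => 0) analyticOnNhd_const h
      exact E.ne_zero_of_im_pos (z := Complex.I) (by simp) (congrFun this _)
    · exact ht.eventually h
  have hfO : (fun _ : ℝ => (1 : ℝ)) =O[nhds x₀] fun x : ℝ => f x := by
    have hpos : 0 < ‖f x₀‖ := norm_pos_iff.2 hne
    refine Asymptotics.IsBigO.of_bound (‖f x₀‖ / 2)⁻¹ ?_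
    filter_upwards [hfc.norm.continuousAt.eventually (lt_mem_nhds (half_lt_self hpos))] with x hx
    rw [norm_one, inv_mul_eq_div, one_le_div (by positivity)]
    exact hx.le
  have hinv := (hEO.mono (nhdsWithin_le_nhds (s := {x₀}ᶜ))).inv_rev
    (hEne.mono fun x hx h => absurd h hx)
  have hmul := (hfO.mono (nhdsWithin_le_nhds (s := {x₀}ᶜ))).mul hinv
  simp only [one_mul] at hmul
  simp only [div_eq_mul_inv]
  exact hmul

namespace DeBrangesSpace

variable {E : DeBrangesFunction}

/-- The element of `H(E)` given by a function with the defining properties. -/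
def ofMem {f : ℂ → ℂ} (hf : MemDeBranges E f) : DeBrangesSpace E :=
  (⟨f, hf⟩ : ↥(deBrangesSubmodule E))

@[simp] theorem ofMem_apply {f : ℂ → ℂ} (hf : MemDeBranges E f) (z : ℂ) : ofMem hf z = f z := rfl

theorem lintegral_enorm_sq_eq (f : DeBrangesSpace E) :
    ∫⁻ x : ℝ, ‖f x / E x‖ₑ ^ 2 = ENNReal.ofReal (‖f‖ ^ 2) := by
  rw [norm_sq_eq_integral, ofReal_integral_eq_lintegral_ofReal]
  · refine lintegral_congr fun x => ?_
    rw [ENNReal.ofReal_pow (norm_nonneg _), ofReal_norm]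
  · exact (memLp_two_iff_integrable_sq_norm f.mem.memLp.1).1 f.mem.memLp
  · exact Filter.Eventually.of_forall fun x => by positivity

theorem inner_eq_integral (f g : DeBrangesSpace E) :
    inner ℂ f g = ∫ x : ℝ, conj (f x / E x) * (g x / E x) := by
  change inner ℂ (toL2 E f) (toL2 E g) = _
  rw [L2.inner_def]
  refine integral_congr_ae ?_
  have hf : (toL2 E f : ℝ → ℂ) =ᵐ[volume] fun x : ℝ => f x / E x := f.mem.memLp.coeFn_toLp
  have hg : (toL2 E g : ℝ → ℂ) =ᵐ[volume] fun x : ℝ => g x / E x := g.mem.memLp.coeFn_toLp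
  filter_upwards [hf, hg] with x h1 h2
  rw [h1, h2, RCLike.inner_apply, mul_comm]

theorem lintegral_conjReflect_eq (f : DeBrangesSpace E) :
    ∫⁻ x : ℝ, ‖conjReflect f x / E x‖ₑ ^ 2 = ENNReal.ofReal (‖f‖ ^ 2) := by
  rw [← lintegral_enorm_sq_eq]
  refine lintegral_congr fun x => ?_
  rw [conjReflect_ofReal, ← ofReal_norm, ← ofReal_norm, norm_div, norm_div, Complex.norm_conj]

/-- Bounding `|x - w|⁻¹` by `1 / Im w` in Jensen's inequality gives a constant that is the boundary
norm itself, so the estimate is linear in the norm of `H(E)`. -/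
theorem norm_div_le_of_hardy {g : ℂ → ℂ} (hc : ContinuousOn g {z : ℂ | 0 ≤ z.im})
    (hg : IsHardyTwo g) (hL : MemLp (fun x : ℝ => g x) 2 volume) {D : ℝ} (hD : 0 ≤ D)
    (hgD : ∫⁻ x : ℝ, ‖g x‖ₑ ^ 2 ≤ ENNReal.ofReal (D ^ 2)) {w : ℂ} (hw : 0 < w.im) :
    ‖g w‖ ≤ D / Real.sqrt w.im := by
  have h1 := enorm_sq_le_lintegral_poisson hc hg hL hw
  have h2 : ∫⁻ x : ℝ, ‖g x‖ₑ ^ 2 * ‖((x : ℂ) - w)⁻¹‖ₑ ^ 2 ≤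
      ENNReal.ofReal (D ^ 2) * ENNReal.ofReal ((w.im)⁻¹ ^ 2) := by
    refine le_trans (lintegral_mono fun x => ?_)
      ((lintegral_mul_const' _ _ ENNReal.ofReal_ne_top).trans_le (by gcongr))
    rw [← ofReal_norm ((x : ℂ) - w)⁻¹, ← ENNReal.ofReal_pow (norm_nonneg _), norm_inv]
    gcongr
    have := Complex.abs_im_le_norm ((x : ℂ) - w)
    simpa [abs_of_pos hw] using this
  have h3 := h1.trans (mul_le_mul_right h2 _)
  rw [← ofReal_norm, ← ENNReal.ofReal_pow (norm_nonneg _), ← ENNReal.ofReal_mul (by positivity),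
    ← ENNReal.ofReal_mul (by positivity), ENNReal.ofReal_le_ofReal_iff (by positivity)] at h3
  rw [← Real.sqrt_sq hD, ← Real.sqrt_div (by positivity)]
  refine Real.le_sqrt_of_sq_le (h3.trans ?_)
  have hpi : 1 ≤ Real.pi := by linarith [Real.pi_gt_three]
  calc w.im / Real.pi * (D ^ 2 * (w.im)⁻¹ ^ 2) = D ^ 2 / w.im / Real.pi := by field_simp
    _ ≤ D ^ 2 / w.im := div_le_self (by positivity) hpi

theorem norm_apply_le_of_im_pos (hE : ∀ x : ℝ, E x ≠ 0) (f : DeBrangesSpace E) {w : ℂ}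
    (hw : 0 < w.im) : ‖f w‖ ≤ ‖E w‖ * (‖f‖ / Real.sqrt w.im) := by
  have h := norm_div_le_of_hardy (DeBrangesFunction.continuousOn_div hE f.mem.entire)
    f.mem.hardy f.mem.memLp (norm_nonneg f) (lintegral_enorm_sq_eq f).le hw
  rwa [norm_div, div_le_iff₀' (norm_pos_iff.2 (E.ne_zero_of_im_pos hw))] at h

theorem norm_apply_conj_le_of_im_pos (hE : ∀ x : ℝ, E x ≠ 0) (f : DeBrangesSpace E) {w : ℂ}
    (hw : 0 < w.im) : ‖f (conj w)‖ ≤ ‖E w‖ * (‖f‖ / Real.sqrt w.im) := by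
  have h := norm_div_le_of_hardy (DeBrangesFunction.continuousOn_div hE f.mem.entire.conjReflect)
    f.mem.hardy_conj (f.mem.memLp_conj hE) (norm_nonneg f) (lintegral_conjReflect_eq f).le hw
  rwa [norm_div, div_le_iff₀' (norm_pos_iff.2 (E.ne_zero_of_im_pos hw)), conjReflect_apply,
    Complex.norm_conj] at h

/-- Point evaluations are bounded on `H(E)`, locally uniformly. -/
theorem exists_norm_apply_le (hE : ∀ x : ℝ, E x ≠ 0) (R : ℝ) :
    ∃ M : ℝ, ∀ (f : DeBrangesSpace E) (z : ℂ), ‖z‖ ≤ R → ‖f z‖ ≤ M * ‖f‖ := by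
  set ρ := 2 * max R 1 with hρ
  have hρ0 : 0 < ρ := by positivity
  obtain ⟨A, hA⟩ := (isCompact_closedBall (0 : ℂ) ρ).exists_bound_of_continuousOn
    E.entire.continuous.continuousOn
  have hA0 : 0 ≤ A := (norm_nonneg _).trans (hA 0 (by simp [hρ0.le]))
  refine ⟨2 * ρ * A * Real.sqrt ρ / (3 / 4 * ρ ^ 2), fun f z hz => ?_⟩
  -- The bounds off the line blow up only like `|Im w|^(-1/2)`, which one factor `|Im w|` absorbs.
  have h := norm_mul_pow_le_of_circle f.mem.entire hρ0 1 (B := 2 * ρ * A * Real.sqrt ρ * ‖f‖)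
    (fun w hw => ?_) (z := z) (by rw [hρ]; linarith [le_max_left R 1])
  · rw [pow_one] at h
    rw [div_mul_eq_mul_div, le_div_iff₀ (by positivity)]
    exact h
  · have key : w.im ≠ 0 → ‖f w‖ ≤ A * (‖f‖ / Real.sqrt |w.im|) := by
      intro hne
      rcases lt_or_gt_of_ne hne with hlt | hgt
      · have h1 := norm_apply_conj_le_of_im_pos hE f (w := conj w) (by simpa using hlt)
        rw [Complex.conj_conj, Complex.conj_im, ← abs_of_neg hlt] at h1
        refine h1.trans ?_
        gcongr
        exact hA _ (by simp [hw])
      · have h1 := norm_apply_le_of_im_pos hE f hgt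
        rw [abs_of_pos hgt]
        refine h1.trans ?_
        gcongr
        exact hA _ (by simp [hw])
    rw [pow_one]
    rcases eq_or_ne w.im 0 with h0 | hne
    · rw [h0]; simp; positivity
    · have hs : 0 < Real.sqrt |w.im| := Real.sqrt_pos.2 (abs_pos.2 hne)
      have hss : Real.sqrt |w.im| * Real.sqrt |w.im| = |w.im| := Real.mul_self_sqrt (abs_nonneg _)
      have hle : Real.sqrt |w.im| ≤ Real.sqrt ρ :=
        Real.sqrt_le_sqrt (hw ▸ Complex.abs_im_le_norm w)
      calc ‖f w‖ * (2 * ρ * |w.im|) ≤ A * (‖f‖ / Real.sqrt |w.im|) * (2 * ρ * |w.im|) := by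
            gcongr
            exact key hne
        _ = 2 * ρ * A * Real.sqrt |w.im| * ‖f‖ := by
            conv_lhs => rw [← hss]
            field_simp
            rw [Real.sq_sqrt (by positivity)]
        _ ≤ _ := by gcongr

theorem norm_toL2_sub (f g : DeBrangesSpace E) : ‖toL2 E f - toL2 E g‖ = ‖f - g‖ := by
  rw [norm_eq, map_sub]

theorem sub_apply (f g : DeBrangesSpace E) (z : ℂ) : (f - g) z = f z - g z := rfl

/-- `H(E)` is complete. -/
theorem completeSpace (hE : ∀ x : ℝ, E x ≠ 0) : CompleteSpace (DeBrangesSpace E) := by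
  refine Metric.complete_of_cauchySeq_tendsto fun u hu => ?_
  have hcau : ∀ z, CauchySeq fun n => u n z := fun z => by
    obtain ⟨M, hM⟩ := exists_norm_apply_le hE ‖z‖
    refine Metric.cauchySeq_iff.2 fun ε hε => ?_
    obtain ⟨N, hN⟩ := Metric.cauchySeq_iff.1 hu (ε / (|M| + 1)) (by positivity)
    refine ⟨N, fun m hm n hn => ?_⟩
    have h1 := hN m hm n hn
    rw [dist_eq_norm, lt_div_iff₀ (by positivity)] at h1
    rw [dist_eq_norm, ← sub_apply]
    refine ((hM _ z le_rfl).trans ?_).trans_lt h1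
    rw [mul_comm]
    gcongr
    linarith [le_abs_self M]
  choose f hf using fun z => cauchySeq_tendsto_of_complete (hcau z)
  have hunif : ∀ R : ℝ, TendstoUniformlyOn (fun n z => u n z) f Filter.atTop
      (Metric.closedBall 0 R) := by
    intro R
    refine UniformCauchySeqOn.tendstoUniformlyOn_of_tendsto ?_ fun z _ => hf z
    obtain ⟨M, hM⟩ := exists_norm_apply_le hE R
    refine Metric.uniformCauchySeqOn_iff.2 fun ε hε => ?_
    obtain ⟨N, hN⟩ := Metric.cauchySeq_iff.1 hu (ε / (|M| + 1)) (by positivity)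
    refine ⟨N, fun m hm n hn z hz => ?_⟩
    have h1 := hN m hm n hn
    rw [dist_eq_norm, lt_div_iff₀ (by positivity)] at h1
    rw [dist_eq_norm, ← sub_apply]
    refine ((hM _ z (by simpa using hz)).trans ?_).trans_lt h1
    rw [mul_comm]
    gcongr
    linarith [le_abs_self M]
  have hfd : Differentiable ℂ f := by
    intro z
    have h1 : TendstoLocallyUniformlyOn (fun n z => u n z) f Filter.atTop
        (Metric.ball 0 (‖z‖ + 1)) :=
      ((hunif (‖z‖ + 1)).mono Metric.ball_subset_closedBall).tendstoLocallyUniformlyOn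
    refine (h1.differentiableOn (Filter.Eventually.of_forall fun n =>
      (u n).mem.entire.differentiableOn) Metric.isOpen_ball).differentiableAt
      (Metric.isOpen_ball.mem_nhds ?_)
    simp
  obtain ⟨B, hB⟩ := hu.norm_bddAbove
  have hB' : ∀ n, ‖u n‖ ≤ B := fun n => hB ⟨n, rfl⟩
  have hub : ∀ n, ENNReal.ofReal (‖u n‖ ^ 2) ≤ ((B ^ 2).toNNReal : ℝ≥0∞) := fun n =>
    ENNReal.ofReal_le_ofReal (by gcongr; exact hB' n)
  -- Norms on horizontal lines are bounded by boundary norms, hence uniformly along the Cauchy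
  -- sequence, and Fatou applies.
  have hhardy : IsHardyTwo (fun z => f z / E z) := by
    refine isHardyTwo_of_tendsto (u := fun n z => u n z / E z)
      (fun n => (u n).mem.hardy.1.continuousOn) (DeBrangesFunction.differentiableOn_div hfd)
      (fun z _ => (hf z).div_const _) (C := (B ^ 2).toNNReal) (fun n y hy => ?_)
    refine (lintegral_line_le (DeBrangesFunction.continuousOn_div hE (u n).mem.entire)
      (u n).mem.hardy (u n).mem.memLp hy).trans ?_
    rw [lintegral_enorm_sq_eq]
    exact hub n
  have hhardy' : IsHardyTwo (fun z => conjReflect f z / E z) := by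
    refine isHardyTwo_of_tendsto (u := fun n z => conjReflect (u n) z / E z)
      (fun n => (u n).mem.hardy_conj.1.continuousOn)
      (DeBrangesFunction.differentiableOn_div hfd.conjReflect)
      (fun z _ => ((Complex.continuous_conj.tendsto _).comp (hf (conj z))).div_const _)
      (C := (B ^ 2).toNNReal) (fun n y hy => ?_)
    refine (lintegral_line_le (DeBrangesFunction.continuousOn_div hE (u n).mem.entire.conjReflect)
      (u n).mem.hardy_conj ((u n).mem.memLp_conj hE) hy).trans ?_
    rw [lintegral_conjReflect_eq]
    exact hub n
  have hcL : CauchySeq fun n => toL2 E (u n) := by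
    refine Metric.cauchySeq_iff.2 fun ε hε => ?_
    obtain ⟨N, hN⟩ := Metric.cauchySeq_iff.1 hu ε hε
    refine ⟨N, fun m hm n hn => ?_⟩
    rw [dist_eq_norm, norm_toL2_sub, ← dist_eq_norm]
    exact hN m hm n hn
  obtain ⟨G, hG⟩ := cauchySeq_tendsto_of_complete hcL
  -- A subsequence converges almost everywhere to the `L²` limit, which identifies it with the
  -- pointwise limit.
  have hGae : (fun x : ℝ => f x / E x) =ᵐ[volume] G := by
    obtain ⟨ns, hns, hae⟩ := (tendstoInMeasure_of_tendsto_Lp hG).exists_seq_tendsto_ae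
    have hall : ∀ᵐ x : ℝ, ∀ n, (toL2 E (u n) : ℝ → ℂ) x = u n x / E x :=
      ae_all_iff.2 fun n => (u n).mem.memLp.coeFn_toLp
    filter_upwards [hae, hall] with x hx hx'
    refine tendsto_nhds_unique (((hf x).comp hns.tendsto_atTop).div_const (E x)) ?_
    simpa only [hx', Function.comp_def] using hx
  have hfm : MemDeBranges E f :=
    ⟨hfd, hhardy, hhardy', (memLp_congr_ae hGae).2 (Lp.memLp G)⟩
  refine ⟨ofMem hfm, ?_⟩
  rw [tendsto_iff_norm_sub_tendsto_zero]
  have hGe : toL2 E (ofMem hfm) = G := by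
    refine Lp.ext ?_
    exact (MemLp.coeFn_toLp hfm.memLp).trans hGae
  have := tendsto_iff_norm_sub_tendsto_zero.1 hG
  rw [← hGe] at this
  simpa only [norm_toL2_sub] using this

end DeBrangesSpace

/-! ### Logarithmic derivatives and a Krein-type theorem -/

theorem isOpen_im_pos : IsOpen {z : ℂ | 0 < z.im} :=
  isOpen_lt continuous_const Complex.continuous_im

/-- A zero-free analytic function on the unit disc bounded by `K / √(1 - ‖ζ‖)`, relative to its
value at the origin, has a controlled logarithmic derivative. -/
theorem norm_logDeriv_le_of_disc {G : ℂ → ℂ} {K : ℝ} (hK : 0 < K)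
    (hG : DifferentiableOn ℂ G (Metric.ball 0 1)) (h0 : ∀ ζ ∈ Metric.ball (0 : ℂ) 1, G ζ ≠ 0)
    (hb : ∀ ζ ∈ Metric.ball (0 : ℂ) 1, ‖G ζ‖ ≤ ‖G 0‖ * (K / Real.sqrt (1 - ‖ζ‖))) {ζ : ℂ}
    (hζ : ‖ζ‖ < 1) :
    ‖deriv G ζ / G ζ‖ ≤ 64 * K / ((1 - ‖ζ‖) ^ 2 * Real.sqrt (1 - ‖ζ‖)) := by
  have hGd : DifferentiableOn ℂ (deriv G) (Metric.ball 0 1) := hG.deriv Metric.isOpen_ball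
  obtain ⟨Ψ, hΨ⟩ := (hGd.div hG h0).isExactOn_ball
  have hmem0 : (0 : ℂ) ∈ Metric.ball (0 : ℂ) 1 := by simp
  -- `Φ` is the branch of `log (G / G 0)` vanishing at the origin, as Borel–Carathéodory requires.
  set Φ : ℂ → ℂ := fun z => Ψ z - Ψ 0 with hΦdef
  have hΦ : ∀ z ∈ Metric.ball (0 : ℂ) 1, HasDerivAt Φ (deriv G z / G z) z :=
    fun z hz => (hΨ z hz).sub_const _
  have hexp : ∀ z ∈ Metric.ball (0 : ℂ) 1, G z = G 0 * Complex.exp (Φ z) := by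
    intro z hz
    have hder : ∀ w ∈ Metric.ball (0 : ℂ) 1,
        HasDerivAt (fun w => G w * Complex.exp (-Φ w)) 0 w := by
      intro w hw
      have h1 := ((hG.differentiableAt (Metric.isOpen_ball.mem_nhds hw)).hasDerivAt).mul
        (hΦ w hw).neg.cexp
      refine h1.congr_deriv ?_
      have := h0 w hw
      field_simp
      ring
    have hconst := Metric.isOpen_ball.is_const_of_deriv_eq_zero
      (convex_ball (0 : ℂ) 1).isPreconnected
      (fun w hw => (hder w hw).differentiableAt.differentiableWithinAt)
      (fun w hw => (hder w hw).deriv) hz hmem0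
    simp only [hΦdef, sub_self, neg_zero, Complex.exp_zero, mul_one] at hconst
    rw [← hconst, mul_assoc, ← Complex.exp_add]
    simp [hΦdef]
  set δ := 1 - ‖ζ‖ with hδ
  have hδ0 : 0 < δ := by linarith
  have hδ1 : δ ≤ 1 := by linarith [norm_nonneg ζ]
  set M := 2 * K / Real.sqrt δ with hM
  have hsδ := Real.sqrt_pos.2 hδ0
  have hM0 : 0 < M := by positivity
  have hsub : Metric.ball (0 : ℂ) (1 - δ / 2) ⊆ Metric.ball 0 1 :=
    Metric.ball_subset_ball (by linarith)
  have hΦd : DifferentiableOn ℂ Φ (Metric.ball 0 1) :=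
    fun z hz => (hΦ z hz).differentiableAt.differentiableWithinAt
  -- `Re Φ = log |G / G 0|` is bounded through `x + 1 ≤ exp x`; on this disc `1 - |z| ≥ δ / 2`.
  have hre : Set.MapsTo Φ (Metric.ball 0 (1 - δ / 2)) {z | z.re ≤ M} := by
    intro z hz
    have hz1 := hsub hz
    have hzn : ‖z‖ < 1 - δ / 2 := by simpa using hz
    have h1 := hb z hz1
    rw [hexp z hz1, norm_mul] at h1
    have h2 := le_of_mul_le_mul_left h1 (norm_pos_iff.2 (h0 0 hmem0))
    rw [Complex.norm_exp] at h2
    have h3 := Real.add_one_le_exp (Φ z).re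
    have h4 : K / Real.sqrt (1 - ‖z‖) ≤ M := by
      have h5 : Real.sqrt δ ≤ 2 * Real.sqrt (1 - ‖z‖) := by
        refine Real.sqrt_le_iff.2 ⟨by positivity, ?_⟩
        rw [mul_pow, Real.sq_sqrt (by linarith)]
        linarith
      have h6 : 0 < Real.sqrt (1 - ‖z‖) := Real.sqrt_pos.2 (by linarith)
      rw [hM, div_le_div_iff₀ h6 hsδ]
      nlinarith
    change (Φ z).re ≤ M
    linarith
  -- The circle stays at distance at least `δ / 4` from the boundary of the disc of radius `1 - δ /
  -- 2`. Cauchy's estimate on it then gives `32 M / δ²`.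
  have hbd : ∀ z ∈ Metric.sphere ζ (δ / 4), ‖Φ z‖ ≤ 8 * M / δ := by
    intro z hz
    have hzn : ‖z‖ ≤ 1 - 3 * δ / 4 := by
      have h1 : ‖z - ζ‖ = δ / 4 := by simpa [dist_eq_norm] using hz
      have h2 := norm_sub_norm_le z ζ
      linarith
    have h1 := Complex.borelCaratheodory_zero hM0 (hΦd.mono hsub) hre (by linarith)
      (z := z) (by simp only [Metric.mem_ball, dist_zero_right]; linarith) (by simp [hΦdef])
    refine h1.trans ?_
    have h2 : δ / 4 ≤ 1 - δ / 2 - ‖z‖ := by linarith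
    calc 2 * M * ‖z‖ / (1 - δ / 2 - ‖z‖) ≤ 2 * M * 1 / (δ / 4) := by gcongr; linarith
      _ = 8 * M / δ := by field_simp; ring
  have hcauchy := Complex.norm_deriv_le_of_forall_mem_sphere_norm_le (f := Φ) (c := ζ)
    (R := δ / 4) (by positivity) ?_ hbd
  · rw [(hΦ ζ (by simpa using hζ)).deriv] at hcauchy
    refine hcauchy.trans (le_of_eq ?_)
    rw [hM]
    field_simp
    ring
  · refine DifferentiableOn.diffContOnCl ?_
    rw [closure_ball _ (by positivity)]
    refine hΦd.mono fun z hz => ?_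
    have h1 : ‖z - ζ‖ ≤ δ / 4 := by simpa [dist_eq_norm] using hz
    have h2 := norm_sub_norm_le z ζ
    simp only [Metric.mem_ball, dist_zero_right]
    linarith

/-- A zero-free analytic function on the upper half plane bounded by `C / √(Im z)` has a
controlled logarithmic derivative. -/
theorem exists_norm_logDeriv_le {g : ℂ → ℂ} {C : ℝ}
    (hg : DifferentiableOn ℂ g {z : ℂ | 0 < z.im}) (h0 : ∀ z : ℂ, 0 < z.im → g z ≠ 0)
    (hb : ∀ z : ℂ, 0 < z.im → ‖g z‖ ≤ C / Real.sqrt z.im) :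
    ∃ D : ℝ, 0 ≤ D ∧ ∀ z : ℂ, 0 < z.im →
      ‖deriv g z / g z‖ ≤ D * ‖z + Complex.I‖ ^ 3 / (z.im ^ 2 * Real.sqrt z.im) := by
  -- The Cayley transform from the disc to the upper half plane, with inverse `(z - i) / (z + i)`.
  set c : ℂ → ℂ := fun ζ => Complex.I * (1 + ζ) / (1 - ζ) with hc
  have hne : ∀ ζ : ℂ, ‖ζ‖ < 1 → 1 - ζ ≠ 0 := fun ζ hζ h => by
    rw [← sub_eq_zero.1 h, norm_one] at hζ
    exact lt_irrefl _ hζ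
  have hcim : ∀ ζ : ℂ, ‖ζ‖ < 1 → (c ζ).im = (1 - ‖ζ‖ ^ 2) / ‖1 - ζ‖ ^ 2 := by
    intro ζ hζ
    have h1 := hne ζ hζ
    simp only [hc, Complex.div_im, Complex.sq_norm, ← sub_div]
    congr 1
    simp [Complex.normSq_apply]
    ring
  have hcpos : ∀ ζ : ℂ, ‖ζ‖ < 1 → (1 - ‖ζ‖) / 4 ≤ (c ζ).im := by
    intro ζ hζ
    rw [hcim ζ hζ]
    have h1 := norm_pos_iff.2 (hne ζ hζ)
    have h2 : ‖1 - ζ‖ ≤ 2 := (norm_sub_le _ _).trans (by rw [norm_one]; linarith)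
    have h3 : ‖1 - ζ‖ ^ 2 ≤ 4 := by nlinarith
    rw [div_le_div_iff₀ (by norm_num) (by positivity)]
    nlinarith [norm_nonneg ζ, mul_nonneg (norm_nonneg ζ) (sub_nonneg.2 hζ.le)]
  have hcd : ∀ ζ : ℂ, ‖ζ‖ < 1 → HasDerivAt c (2 * Complex.I / (1 - ζ) ^ 2) ζ := by
    intro ζ hζ
    have h1 := hne ζ hζ
    have := (((hasDerivAt_id ζ).const_add 1).const_mul Complex.I).div
      ((hasDerivAt_id ζ).const_sub 1) h1
    refine this.congr_deriv ?_
    simp only [id]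
    congr 1
    ring
  have hpos : ∀ ζ : ℂ, ‖ζ‖ < 1 → 0 < (c ζ).im := fun ζ hζ =>
    lt_of_lt_of_le (by linarith) (hcpos ζ hζ)
  have hGder : ∀ ζ : ℂ, ‖ζ‖ < 1 →
      HasDerivAt (g ∘ c) (deriv g (c ζ) * (2 * Complex.I / (1 - ζ) ^ 2)) ζ := fun ζ hζ =>
    HasDerivAt.comp ζ
      (hg.differentiableAt (isOpen_im_pos.mem_nhds (hpos ζ hζ))).hasDerivAt (hcd ζ hζ)
  have hC : 0 < C := by
    have h1 := (norm_pos_iff.2 (h0 Complex.I (by simp))).trans_le (hb Complex.I (by simp))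
    simpa using h1
  have hG0 : 0 < ‖(g ∘ c) 0‖ := norm_pos_iff.2 (h0 _ (hpos 0 (by simp)))
  set K := 2 * C / ‖(g ∘ c) 0‖ with hK
  have hK0 : 0 < K := by positivity
  refine ⟨128 * K, by positivity, fun z hz => ?_⟩
  have hzi : z + Complex.I ≠ 0 := fun h => by
    have := congrArg Complex.im h
    simp at this
    linarith
  set ζ := (z - Complex.I) / (z + Complex.I) with hζdef
  have h1ζ : 1 - ζ = 2 * Complex.I / (z + Complex.I) := by
    rw [hζdef]; field_simp; ring
  have hcz : c ζ = z := by
    simp only [hc]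
    rw [h1ζ, hζdef]
    have := Complex.I_ne_zero
    field_simp
    ring
  set s := ‖z + Complex.I‖ with hs
  have hs0 : 0 < s := norm_pos_iff.2 hzi
  have hζsq : 1 - ‖ζ‖ ^ 2 = 4 * z.im / s ^ 2 := by
    have : ‖z - Complex.I‖ ^ 2 = s ^ 2 - 4 * z.im := by
      rw [hs, Complex.sq_norm, Complex.sq_norm, Complex.normSq_apply, Complex.normSq_apply]
      simp
      ring
    rw [hζdef, norm_div, div_pow, ← hs, this]
    field_simp
    ring
  have hζ1 : ‖ζ‖ < 1 := by
    have : 0 < 1 - ‖ζ‖ ^ 2 := by rw [hζsq]; positivity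
    nlinarith [norm_nonneg ζ]
  have hδ : z.im / s ^ 2 ≤ 1 - ‖ζ‖ := by
    have h2 : 4 * (z.im / s ^ 2) = (1 - ‖ζ‖) * (1 + ‖ζ‖) := by
      rw [← mul_div_assoc, ← hζsq]; ring
    nlinarith [norm_nonneg ζ]
  have hq := norm_logDeriv_le_of_disc (G := g ∘ c) hK0
    (fun w hw => (hGder w (by simpa using hw)).differentiableAt.differentiableWithinAt)
    (fun w hw => h0 _ (hpos w (by simpa using hw))) (fun w hw => ?_) hζ1
  · rw [(hGder ζ hζ1).deriv, Function.comp_apply, hcz, h1ζ] at hq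
    have hL : ‖deriv g z * (2 * Complex.I / (2 * Complex.I / (z + Complex.I)) ^ 2) / g z‖ =
        ‖deriv g z / g z‖ * s ^ 2 / 2 := by
      rw [norm_div, norm_mul, norm_div, norm_pow, norm_div, norm_div, ← hs]
      simp
      field_simp
    rw [hL] at hq
    -- The power `5/2` of `Im z / s²` produces `s ^ 5`; the derivative of the Cayley transform, of
    -- modulus `s² / 2`, leaves `s ^ 3`.
    have hden : z.im ^ 2 * Real.sqrt z.im / s ^ 5 ≤
        (1 - ‖ζ‖) ^ 2 * Real.sqrt (1 - ‖ζ‖) := by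
      calc z.im ^ 2 * Real.sqrt z.im / s ^ 5 = (z.im / s ^ 2) ^ 2 * Real.sqrt (z.im / s ^ 2) := by
            rw [Real.sqrt_div hz.le, Real.sqrt_sq hs0.le]
            field_simp
        _ ≤ _ := by gcongr
    have hsy := Real.sqrt_pos.2 hz
    have hq2 : ‖deriv g z / g z‖ * s ^ 2 / 2 ≤
        64 * K / (z.im ^ 2 * Real.sqrt z.im / s ^ 5) :=
      hq.trans (by gcongr)
    have : ‖deriv g z / g z‖ = (‖deriv g z / g z‖ * s ^ 2 / 2) * (2 / s ^ 2) := by field_simp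
    rw [this]
    refine (mul_le_mul_of_nonneg_right hq2 (by positivity)).trans (le_of_eq ?_)
    field_simp
    ring
  · have hw1 : ‖w‖ < 1 := by simpa using hw
    refine (hb _ (hpos w hw1)).trans ?_
    rw [hK]
    have h4 : 0 < 1 - ‖w‖ := by linarith
    have h5 : Real.sqrt (1 - ‖w‖) / 2 ≤ Real.sqrt (c w).im := by
      have : Real.sqrt ((1 - ‖w‖) / 4) = Real.sqrt (1 - ‖w‖) / 2 := by
        rw [Real.sqrt_div h4.le, show (4 : ℝ) = 2 ^ 2 by norm_num, Real.sqrt_sq (by norm_num)]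
      rw [← this]
      exact Real.sqrt_le_sqrt (hcpos w hw1)
    have h6 := Real.sqrt_pos.2 h4
    calc C / Real.sqrt (c w).im ≤ C / (Real.sqrt (1 - ‖w‖) / 2) := by gcongr
      _ = _ := by field_simp

/-- A Liouville theorem for entire functions whose growth is controlled away from the real
line. -/
theorem deriv_eq_zero_of_norm_le {L : ℂ → ℂ} (hL : Differentiable ℂ L) {D : ℝ} (hD : 0 ≤ D)
    (hb : ∀ z : ℂ, z.im ≠ 0 → ‖L z‖ ≤ D * (‖z‖ + 1) ^ 3 / (z.im ^ 2 * Real.sqrt |z.im|)) (z : ℂ) :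
    deriv L z = 0 := by
  -- The exponent 3 absorbs the singularity `|Im z|^(-5/2)`. The resulting growth `√ρ` is sublinear,
  -- so Cauchy's estimate kills the derivative; `160` exceeds `64² / 27`.
  have hgrow : ∀ ρ : ℝ, 1 ≤ ρ → ∀ w : ℂ, ‖w‖ ≤ ρ / 2 → ‖L w‖ ≤ 160 * D * Real.sqrt ρ := by
    intro ρ hρ w hw
    have hρ0 : 0 < ρ := by linarith
    have h := norm_mul_pow_le_of_circle hL hρ0 3 (B := 64 * D * ρ ^ 6 * Real.sqrt ρ)
      (fun v hv => ?_) hw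
    · have h1 : (3 / 4 * ρ ^ 2) ^ 3 = 27 / 64 * ρ ^ 6 := by ring
      rw [h1] at h
      have h2 : ‖L w‖ * (27 / 64) ≤ 64 * D * Real.sqrt ρ := by
        refine le_of_mul_le_mul_right (a := ρ ^ 6) ?_ (by positivity)
        linarith
      have : 0 ≤ D * Real.sqrt ρ := by positivity
      linarith
    · rcases eq_or_ne v.im 0 with h0 | hne
      · rw [h0]; simp; positivity
      · have ha := abs_pos.2 hne
        have hs := Real.sqrt_pos.2 ha
        have hle : Real.sqrt |v.im| ≤ Real.sqrt ρ :=
          Real.sqrt_le_sqrt (hv ▸ Complex.abs_im_le_norm v)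
        have hρ3 : (ρ + 1) ^ 3 ≤ 8 * ρ ^ 3 := by
          calc (ρ + 1) ^ 3 ≤ (2 * ρ) ^ 3 := by gcongr; linarith
            _ = _ := by ring
        calc ‖L v‖ * (2 * ρ * |v.im|) ^ 3
            ≤ D * (‖v‖ + 1) ^ 3 / (v.im ^ 2 * Real.sqrt |v.im|) * (2 * ρ * |v.im|) ^ 3 := by
              gcongr
              exact hb v hne
          _ = 8 * D * (ρ + 1) ^ 3 * ρ ^ 3 * Real.sqrt |v.im| := by
              rw [hv, ← sq_abs v.im]
              have : |v.im| = Real.sqrt |v.im| ^ 2 := (Real.sq_sqrt ha.le).symm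
              field_simp
              rw [← this]
              ring
          _ ≤ 8 * D * (8 * ρ ^ 3) * ρ ^ 3 * Real.sqrt ρ := by gcongr
          _ = _ := by ring
  have hlim : Filter.Tendsto (fun ρ : ℝ => 640 * D / Real.sqrt ρ) Filter.atTop (nhds 0) :=
    Real.tendsto_sqrt_atTop.const_div_atTop _
  have hle : ‖deriv L z‖ ≤ 0 := by
    refine ge_of_tendsto hlim ?_
    filter_upwards [Filter.eventually_ge_atTop (4 * (‖z‖ + 1))] with ρ hρ
    have hρ0 : 1 ≤ ρ := by linarith [norm_nonneg z]
    have hs := Real.sqrt_pos.2 (lt_of_lt_of_le one_pos hρ0)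
    refine (Complex.norm_deriv_le_of_forall_mem_sphere_norm_le (f := L) (c := z) (R := ρ / 4)
      (C := 160 * D * Real.sqrt ρ) (by linarith) hL.diffContOnCl fun w hw => ?_).trans
      (le_of_eq ?_)
    · refine hgrow ρ hρ0 w ?_
      have h1 : ‖w - z‖ = ρ / 4 := by simpa [dist_eq_norm] using hw
      have h2 := norm_sub_norm_le w z
      linarith
    · have : Real.sqrt ρ ^ 2 = ρ := Real.sq_sqrt (by linarith)
      field_simp
      rw [this]
      ring
  exact norm_le_zero_iff.1 hle

/-- A Krein-type theorem: a symmetric zero-free entire function that is a quotient of functions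
in the Hardy space is an exponential. -/
theorem exists_eq_mul_exp {θ g₁ g₂ : ℂ → ℂ} {C₁ C₂ : ℝ} (hθ : Differentiable ℂ θ)
    (hsymm : ∀ z, θ z * conj (θ (conj z)) = 1)
    (hd₁ : DifferentiableOn ℂ g₁ {z : ℂ | 0 < z.im}) (hd₂ : DifferentiableOn ℂ g₂ {z : ℂ | 0 < z.im})
    (h₁ : ∀ z : ℂ, 0 < z.im → g₁ z ≠ 0) (h₂ : ∀ z : ℂ, 0 < z.im → g₂ z ≠ 0)
    (hb₁ : ∀ z : ℂ, 0 < z.im → ‖g₁ z‖ ≤ C₁ / Real.sqrt z.im)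
    (hb₂ : ∀ z : ℂ, 0 < z.im → ‖g₂ z‖ ≤ C₂ / Real.sqrt z.im)
    (heq : ∀ z : ℂ, 0 < z.im → θ z * g₂ z = g₁ z) :
    ∃ (α : ℝ) (c : ℂ), ‖c‖ = 1 ∧ ∀ z, θ z = c * Complex.exp (2 * Complex.I * α * z) := by
  have hθ0 : ∀ z, θ z ≠ 0 := fun z h => by
    have := hsymm z
    rw [h, zero_mul] at this
    exact zero_ne_one this
  set L : ℂ → ℂ := fun z => deriv θ z / θ z with hLdef
  have hθ' : Differentiable ℂ (deriv θ) := hθ.deriv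
  have hLd : Differentiable ℂ L := hθ'.div hθ hθ0
  obtain ⟨D₁, hD₁, hL₁⟩ := exists_norm_logDeriv_le hd₁ h₁ hb₁
  obtain ⟨D₂, hD₂, hL₂⟩ := exists_norm_logDeriv_le hd₂ h₂ hb₂
  have hup : ∀ z : ℂ, 0 < z.im →
      ‖L z‖ ≤ (D₁ + D₂) * (‖z‖ + 1) ^ 3 / (z.im ^ 2 * Real.sqrt |z.im|) := by
    intro z hz
    have hev : g₁ =ᶠ[nhds z] fun w => θ w * g₂ w :=
      Filter.eventuallyEq_of_mem (isOpen_im_pos.mem_nhds hz) fun w hw => (heq w hw).symm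
    have hder : deriv g₁ z = deriv θ z * g₂ z + θ z * deriv g₂ z := by
      rw [hev.deriv_eq]
      exact ((hθ z).hasDerivAt.mul
        (hd₂.differentiableAt (isOpen_im_pos.mem_nhds hz)).hasDerivAt).deriv
    have hL : L z = deriv g₁ z / g₁ z - deriv g₂ z / g₂ z := by
      rw [hder, ← heq z hz]
      simp only [hLdef]
      have := hθ0 z
      have := h₂ z hz
      field_simp
      ring
    rw [hL, abs_of_pos hz]
    refine (norm_sub_le _ _).trans ((add_le_add (hL₁ z hz) (hL₂ z hz)).trans ?_)
    rw [← add_div, ← add_mul]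
    gcongr
    exact (norm_add_le _ _).trans (by simp)
  -- Logarithmic differentiation of the symmetry relation; it carries the bound to the lower half
  -- plane.
  have hLsymm : ∀ z, L (conj z) = -conj (L z) := by
    intro z
    have hd : HasDerivAt (fun w => θ w * conj (θ (conj w)))
        (deriv θ (conj z) * conj (θ z) + θ (conj z) * conj (deriv θ z)) (conj z) := by
      have h1 := (hθ z).hasDerivAt.conj_conj
      have h2 := (hθ (conj z)).hasDerivAt.mul h1
      exact h2.congr_deriv (by simp)
    have hc : HasDerivAt (fun w => θ w * conj (θ (conj w))) 0 (conj z) := by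
      simp_rw [hsymm]
      exact hasDerivAt_const _ _
    have h3 := hd.unique hc
    simp only [hLdef, map_div₀]
    have h4 := hθ0 (conj z)
    have h5 : conj (θ z) ≠ 0 := by simpa using hθ0 z
    field_simp
    linear_combination h3
  have hLb : ∀ z : ℂ, z.im ≠ 0 →
      ‖L z‖ ≤ (D₁ + D₂) * (‖z‖ + 1) ^ 3 / (z.im ^ 2 * Real.sqrt |z.im|) := by
    intro z hz
    rcases lt_or_gt_of_ne hz with h | h
    · have h1 := hup (conj z) (by simpa using h)
      rw [hLsymm, norm_neg, Complex.norm_conj, Complex.norm_conj, Complex.conj_im, neg_sq,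
        abs_neg] at h1
      exact h1
    · exact hup z h
  have hLc : ∀ z, L z = L 0 := fun z =>
    is_const_of_deriv_eq_zero hLd (deriv_eq_zero_of_norm_le hLd (by positivity) hLb) z 0
  set a := L 0 with ha
  have hθexp : ∀ z, θ z = θ 0 * Complex.exp (a * z) := by
    intro z
    have hder : ∀ w, HasDerivAt (fun w => θ w * Complex.exp (-(a * w))) 0 w := by
      intro w
      have h1 := (hθ w).hasDerivAt.mul (((hasDerivAt_id w).const_mul a).neg.cexp)
      refine h1.congr_deriv ?_
      have h2 : deriv θ w = a * θ w := by
        rw [← hLc w]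
        simp only [hLdef]
        rw [div_mul_cancel₀ _ (hθ0 w)]
      rw [h2]
      simp
      ring
    have h3 := is_const_of_deriv_eq_zero (fun w => (hder w).differentiableAt)
      (fun w => (hder w).deriv) z 0
    simp only [mul_zero, neg_zero, Complex.exp_zero, mul_one] at h3
    rw [← h3, mul_assoc, ← Complex.exp_add]
    simp
  have hnorm : ∀ x : ℝ, ‖θ x‖ = 1 := by
    intro x
    have h := hsymm x
    rw [Complex.conj_ofReal, Complex.mul_conj'] at h
    have h1 : ‖θ x‖ ^ 2 = 1 := by exact_mod_cast h
    nlinarith [norm_nonneg (θ x)]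
  have hn0 : ‖θ 0‖ = 1 := by simpa using hnorm 0
  -- Unimodularity on the real line forces the exponent to be imaginary.
  have hre : a.re = 0 := by
    have h1 := hnorm 1
    rw [hθexp, norm_mul, hn0, one_mul, Complex.norm_exp] at h1
    simpa using h1
  refine ⟨a.im / 2, θ 0, hn0, fun z => ?_⟩
  rw [hθexp z]
  congr 3
  apply Complex.ext
  · simp [hre]
  · simp
    ring

/-! ### The reproducing kernel of a de Branges space -/

/-- At height `y` the squared majorant integrates to `D² π / (Im w + y)`. -/
theorem isHardyTwo_of_norm_le {g : ℂ → ℂ} {w : ℂ} (hw : 0 < w.im) {D : ℝ}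
    (hg : DifferentiableOn ℂ g {z : ℂ | 0 < z.im})
    (hb : ∀ z : ℂ, 0 < z.im → ‖g z‖ ≤ D * ‖(z - conj w)⁻¹‖) : IsHardyTwo g := by
  refine ⟨hg, (D ^ 2 * (Real.pi / w.im)).toNNReal, fun y hy => ?_⟩
  set v : ℂ := conj w - y * Complex.I with hv
  have hvim : v.im = -(w.im + y) := by simp [hv]; ring
  have hv0 : v.im ≠ 0 := by rw [hvim]; linarith
  calc ∫⁻ x : ℝ, ‖g (x + y * Complex.I)‖ₑ ^ 2
      ≤ ∫⁻ x : ℝ, ENNReal.ofReal (D ^ 2 * ‖((x : ℂ) - v)⁻¹‖ ^ 2) := by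
        refine lintegral_mono fun x => ?_
        rw [← ofReal_norm, ← ENNReal.ofReal_pow (norm_nonneg _), ← mul_pow]
        gcongr
        refine (hb _ (by simpa using hy)).trans (le_of_eq ?_)
        rw [hv]
        congr 3
        ring
    _ = ENNReal.ofReal (D ^ 2 * (Real.pi / |v.im|)) := by
        rw [← integral_norm_inv_ofReal_sub_sq v hv0, ← integral_const_mul,
          ofReal_integral_eq_lintegral_ofReal
            ((integrable_norm_inv_ofReal_sub_sq v hv0).const_mul _)
            (Filter.Eventually.of_forall fun x => by positivity)]
    _ ≤ ENNReal.ofReal (D ^ 2 * (Real.pi / w.im)) := by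
        gcongr
        rw [hvim, abs_neg, abs_of_pos (by linarith)]
        linarith

namespace DeBrangesFunction

theorem norm_conjReflect_le (E : DeBrangesFunction) {z : ℂ} (hz : 0 ≤ z.im) :
    ‖conjReflect E z‖ ≤ ‖E z‖ := by
  rw [conjReflect_apply, Complex.norm_conj]
  rcases hz.lt_or_eq with h | h
  · exact (E.norm_conj_lt z h).le
  · rw [Complex.conj_eq_iff_im.2 h.symm]

/-- `k` is the reproducing kernel function of `H(E)` at the point `w`. -/
def IsKernelAt (E : DeBrangesFunction) (w : ℂ) (k : ℂ → ℂ) : Prop :=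
  Differentiable ℂ k ∧ ∀ z, 2 * Real.pi * Complex.I * (conj w - z) * k z =
    E z * conj (E w) - conjReflect E z * conj (conjReflect E w)

variable {E : DeBrangesFunction} {w : ℂ} {k : ℂ → ℂ}

/-- Both terms of the kernel formula are dominated by `|E z|`, because `|E^*| ≤ |E|` in the closed
upper half plane. -/
theorem IsKernelAt.norm_div_le (hk : E.IsKernelAt w k) (hE : ∀ x : ℝ, E x ≠ 0) {z : ℂ}
    (hz : 0 ≤ z.im) :
    ‖z - conj w‖ * ‖k z / E z‖ ≤ ‖E w‖ + ‖conjReflect E w‖ := by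
  have hEz := norm_pos_iff.2 (ne_zero_of_im_nonneg hE hz)
  have h1 := congrArg norm (hk.2 z)
  simp only [norm_mul, Complex.norm_I, Complex.norm_real, RCLike.norm_ofNat,
    Real.norm_of_nonneg Real.pi_pos.le, mul_one, norm_sub_rev (conj w)] at h1
  have h2 : ‖E z * conj (E w) - conjReflect E z * conj (conjReflect E w)‖ ≤
      ‖E z‖ * (‖E w‖ + ‖conjReflect E w‖) := by
    refine (norm_sub_le _ _).trans ?_
    rw [norm_mul, norm_mul, Complex.norm_conj, Complex.norm_conj, mul_add]
    gcongr
    exact E.norm_conjReflect_le hz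
  rw [← h1] at h2
  rw [norm_div, ← mul_div_assoc, div_le_iff₀ hEz, mul_comm _ ‖E z‖]
  refine le_trans ?_ h2
  have h3 : 0 ≤ ‖z - conj w‖ * ‖k z‖ := by positivity
  nlinarith [Real.pi_gt_three]

theorem IsKernelAt.norm_conjReflect_div_le (hk : E.IsKernelAt w k) (hE : ∀ x : ℝ, E x ≠ 0)
    {z : ℂ} (hz : 0 ≤ z.im) :
    ‖z - w‖ * ‖conjReflect k z / E z‖ ≤ ‖E w‖ + ‖conjReflect E w‖ := by
  have hEz := norm_pos_iff.2 (ne_zero_of_im_nonneg hE hz)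
  have h1 := congrArg norm (hk.2 (conj z))
  simp only [norm_mul, Complex.norm_I, Complex.norm_real, RCLike.norm_ofNat,
    Real.norm_of_nonneg Real.pi_pos.le, mul_one, ← map_sub, Complex.norm_conj,
    norm_sub_rev w] at h1
  have h2 : ‖E (conj z) * conj (E w) - conjReflect E (conj z) * conj (conjReflect E w)‖ ≤
      ‖E z‖ * (‖E w‖ + ‖conjReflect E w‖) := by
    refine (norm_sub_le _ _).trans ?_
    have h3 : ‖conjReflect E (conj z)‖ = ‖E z‖ := by
      rw [conjReflect_apply, Complex.conj_conj, Complex.norm_conj]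
    have h4 := E.norm_conjReflect_le hz
    rw [conjReflect_apply, Complex.norm_conj] at h4
    rw [norm_mul, norm_mul, Complex.norm_conj, Complex.norm_conj, mul_add, h3]
    gcongr
  rw [← h1] at h2
  rw [norm_div, ← mul_div_assoc, div_le_iff₀ hEz, mul_comm _ ‖E z‖, conjReflect_apply,
    Complex.norm_conj]
  refine le_trans ?_ h2
  have h3 : 0 ≤ ‖z - w‖ * ‖k (conj z)‖ := by positivity
  nlinarith [Real.pi_gt_three]

/-- For `k` the factor `z - conj w` never vanishes above the line. For `k^*` it is `z - w`, which
vanishes at `w`, so continuity is used near `w` and the kernel bound elsewhere. -/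
theorem IsKernelAt.memDeBranges (hk : E.IsKernelAt w k) (hE : ∀ x : ℝ, E x ≠ 0)
    (hw : 0 < w.im) : MemDeBranges E k := by
  set S := ‖E w‖ + ‖conjReflect E w‖ with hS
  have hS0 : 0 ≤ S := by positivity
  have hne : ∀ z : ℂ, 0 ≤ z.im → 0 < ‖z - conj w‖ := fun z hz => norm_pos_iff.2 fun h => by
    have := congrArg Complex.im h
    simp at this
    linarith
  have hkb : ∀ z : ℂ, 0 ≤ z.im → ‖k z / E z‖ ≤ S * ‖(z - conj w)⁻¹‖ := fun z hz => by
    rw [norm_inv, ← div_eq_mul_inv, le_div_iff₀' (hne z hz)]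
    exact hk.norm_div_le hE hz
  refine ⟨hk.1, isHardyTwo_of_norm_le hw (differentiableOn_div hk.1)
    fun z hz => hkb z hz.le, ?_, ?_⟩
  · have hd := differentiableOn_div (E := E) hk.1.conjReflect
    have hcw : ContinuousAt (fun z => conjReflect k z / E z) w :=
      (hd.differentiableAt (isOpen_im_pos.mem_nhds hw)).continuousAt
    set M := ‖conjReflect k w / E w‖ + 1 with hM
    obtain ⟨δ, hδ0, hδ⟩ := Metric.eventually_nhds_iff.1
      (hcw.norm.eventually (gt_mem_nhds (lt_add_one ‖conjReflect k w / E w‖)))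
    -- The first summand serves `|z - w| < δ`, the second its complement; both use `|z - conj w| ≤
    -- |z - w| + 2 Im w`.
    refine isHardyTwo_of_norm_le hw (D := M * (δ + 2 * w.im) + S * (1 + 2 * w.im / δ))
      hd fun z hz => ?_
    have htri : ‖z - conj w‖ ≤ ‖z - w‖ + 2 * w.im := by
      have h1 : z - conj w = (z - w) + (2 * w.im : ℝ) * Complex.I := by
        rw [show ((2 * w.im : ℝ) : ℂ) * Complex.I = w - conj w from (Complex.sub_conj w).symm]
        ring
      rw [h1]
      refine (norm_add_le _ _).trans ?_
      simp [abs_of_pos hw]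
    rw [norm_inv, ← div_eq_mul_inv, le_div_iff₀ (hne z hz.le)]
    rcases lt_or_ge ‖z - w‖ δ with h | h
    · have h1 := hδ (y := z) (by rwa [dist_eq_norm])
      calc ‖conjReflect k z / E z‖ * ‖z - conj w‖ ≤ M * (δ + 2 * w.im) := by
            gcongr
            linarith
        _ ≤ _ := le_add_of_nonneg_right (by positivity)
    · have h1 := hk.norm_conjReflect_div_le hE hz.le
      have h2 : ‖z - conj w‖ ≤ ‖z - w‖ * (1 + 2 * w.im / δ) := by
        refine htri.trans ?_
        rw [mul_add, mul_one, mul_div_assoc', add_le_add_iff_left, le_div_iff₀ hδ0]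
        nlinarith
      calc ‖conjReflect k z / E z‖ * ‖z - conj w‖
          ≤ ‖conjReflect k z / E z‖ * (‖z - w‖ * (1 + 2 * w.im / δ)) := by gcongr
        _ = ‖z - w‖ * ‖conjReflect k z / E z‖ * (1 + 2 * w.im / δ) := by ring
        _ ≤ S * (1 + 2 * w.im / δ) := by gcongr
        _ ≤ _ := le_add_of_nonneg_left (by positivity)
  · refine MemLp.of_le_mul (c := S) (memLp_inv_ofReal_sub (conj w) (by simpa using hw.ne')) ?_
      (Filter.Eventually.of_forall fun x => hkb x (by simp))
    exact ((continuousOn_div hE hk.1).comp_continuous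
      Complex.continuous_ofReal (fun x => by simp)).aestronglyMeasurable

end DeBrangesFunction

namespace DeBrangesSpace

variable {E : DeBrangesFunction}

/-- The kernel formula splits the integral in two. The Cauchy formula for `f / E` at `w` yields `f
w`; the other part is the conjugate of a Cauchy integral of `f^* / E` at `conj w`, which vanishes.
-/
theorem inner_kernel (hE : ∀ x : ℝ, E x ≠ 0) {w : ℂ} (hw : 0 < w.im) (k f : DeBrangesSpace E)
    (hk : E.IsKernelAt w k) : inner ℂ k f = f w := by
  have hw0 := hw.ne'
  have hπ : (2 * Real.pi * Complex.I : ℂ) ≠ 0 := Complex.two_pi_I_ne_zero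
  have hwc : (conj w).im < 0 := by simpa using hw
  have h1 := integral_div_sub_eq (DeBrangesFunction.continuousOn_div hE f.mem.entire)
    f.mem.hardy f.mem.memLp hw
  have h2 : ∫ x : ℝ, (f x / conj (E x)) / (x - w) = 0 := by
    have h3 := integral_div_sub_eq_zero
      (DeBrangesFunction.continuousOn_div hE f.mem.entire.conjReflect)
      f.mem.hardy_conj (f.mem.memLp_conj hE) hwc
    have h4 := congrArg conj h3
    rw [← integral_conj, map_zero] at h4
    rw [← h4]
    refine integral_congr_ae (Filter.Eventually.of_forall fun x => ?_)
    simp [conjReflect_ofReal]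
  have hi1 : Integrable (fun x : ℝ => (f x / E x) / (x - w)) := by
    simp_rw [div_eq_mul_inv _ ((_ : ℂ) - w)]
    exact f.mem.memLp.integrable_mul (memLp_inv_ofReal_sub w hw0)
  have hi2 : Integrable (fun x : ℝ => (f x / conj (E x)) / (x - w)) := by
    have hm : MemLp (fun x : ℝ => f x / conj (E x)) 2 volume := by
      refine f.mem.memLp.of_le ?_ (Filter.Eventually.of_forall fun x => ?_)
      · refine Continuous.aestronglyMeasurable (Continuous.div ?_ ?_ fun x => ?_)
        · exact f.mem.entire.continuous.comp Complex.continuous_ofReal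
        · exact Complex.continuous_conj.comp (E.entire.continuous.comp Complex.continuous_ofReal)
        · simpa using hE x
      · rw [norm_div, norm_div, Complex.norm_conj]
    simp_rw [div_eq_mul_inv _ ((_ : ℂ) - w)]
    exact hm.integrable_mul (memLp_inv_ofReal_sub w hw0)
  have hpt : ∀ x : ℝ, conj (k x / E x) * (f x / E x) =
      (2 * Real.pi * Complex.I)⁻¹ * (E w * ((f x / E x) / (x - w))
        - conjReflect E w * ((f x / conj (E x)) / (x - w))) := by
    intro x
    have h3 := congrArg conj (hk.2 x)
    simp only [map_mul, map_sub, Complex.conj_conj, Complex.conj_ofReal, Complex.conj_I,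
      map_ofNat, conjReflect_ofReal] at h3
    have h5 := ofReal_sub_ne_zero hw0 x
    have h6 := hE x
    have h7 : conj (E x) ≠ 0 := by simpa using h6
    have h8 : conj (k x) = (2 * Real.pi * Complex.I)⁻¹ * (conj (E x) * E w
        - E x * conjReflect E w) / (x - w) := by
      rw [eq_div_iff h5, eq_inv_mul_iff_mul_eq₀ hπ, ← h3]
      ring
    rw [map_div₀, h8]
    field_simp
  rw [inner_eq_integral]
  simp_rw [hpt]
  rw [integral_const_mul, integral_sub (hi1.const_mul _) (hi2.const_mul _), integral_const_mul,
    integral_const_mul, h1, h2, mul_zero, sub_zero]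
  have h6 := E.ne_zero_of_im_pos hw
  field_simp

end DeBrangesSpace

/-! ### Isometry from equal Gram matrices -/

/-- Hilbert spaces generated by families of vectors with the same Gram matrix are isometric. -/
theorem exists_of_inner_eq {X H₁ H₂ : Type*} [NormedAddCommGroup H₁] [InnerProductSpace ℂ H₁]
    [CompleteSpace H₁] [NormedAddCommGroup H₂] [InnerProductSpace ℂ H₂] [CompleteSpace H₂]
    (k₁ : X → H₁) (k₂ : X → H₂) (hk : ∀ x y, inner ℂ (k₁ x) (k₁ y) = inner ℂ (k₂ x) (k₂ y))
    (htot : ∀ f : H₁, (∀ x, inner ℂ (k₁ x) f = 0) → f = 0) (f : H₁) :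
    ∃ f' : H₂, (∀ x, inner ℂ (k₂ x) f' = inner ℂ (k₁ x) f) ∧ ‖f'‖ = ‖f‖ := by
  -- `P` is the graph of the isometry between the spans; working with pairs avoids a separate proof
  -- that the map is well defined.
  set P : Submodule ℂ (H₁ × H₂) := Submodule.span ℂ (Set.range fun x => (k₁ x, k₂ x)) with hP
  have hP1 : ∀ p ∈ P, ∀ x, inner ℂ (k₁ x) p.1 = inner ℂ (k₂ x) p.2 := by
    intro p hp x
    induction hp using Submodule.span_induction with
    | mem p hp => obtain ⟨y, rfl⟩ := hp; exact hk x y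
    | zero => simp
    | add p q _ _ hp hq => simp only [Prod.fst_add, Prod.snd_add, inner_add_right, hp, hq]
    | smul c p _ hp => simp only [Prod.smul_fst, Prod.smul_snd, inner_smul_right, hp]
  have hP2 : ∀ q ∈ P, ∀ p ∈ P, inner ℂ q.1 p.1 = inner ℂ q.2 p.2 := by
    intro q hq p hp
    induction hq using Submodule.span_induction with
    | mem q hq => obtain ⟨y, rfl⟩ := hq; exact hP1 p hp y
    | zero => simp
    | add q r _ _ hq hr => simp only [Prod.fst_add, Prod.snd_add, inner_add_left, hq, hr]
    | smul c q _ hq => simp only [Prod.smul_fst, Prod.smul_snd, inner_smul_left, hq]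
  have hPn : ∀ p ∈ P, ‖p.2‖ = ‖p.1‖ := by
    intro p hp
    rw [@norm_eq_sqrt_re_inner ℂ, @norm_eq_sqrt_re_inner ℂ, hP2 p hp p hp]
  have hdense : (Submodule.span ℂ (Set.range k₁)).topologicalClosure = ⊤ := by
    rw [Submodule.topologicalClosure_eq_top_iff, Submodule.eq_bot_iff]
    intro g hg
    exact htot g fun x =>
      (Submodule.mem_orthogonal _ g).1 hg _ (Submodule.subset_span ⟨x, rfl⟩)
  have hfm : f ∈ closure (Submodule.span ℂ (Set.range k₁) : Set H₁) := by
    rw [← Submodule.topologicalClosure_coe, hdense]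
    trivial
  obtain ⟨a, ha, hlim⟩ := mem_closure_iff_seq_limit.1 hfm
  have hlift : ∀ n, ∃ b, (a n, b) ∈ P := by
    intro n
    have h1 : Submodule.span ℂ (Set.range k₁) = P.map (LinearMap.fst ℂ H₁ H₂) := by
      rw [hP, Submodule.map_span, ← Set.range_comp]
      rfl
    have h2 := ha n
    rw [SetLike.mem_coe, h1] at h2
    obtain ⟨p, hp, hpa⟩ := h2
    exact ⟨p.2, by rw [← hpa]; exact hp⟩
  choose b hb using hlift
  have hbc : CauchySeq b := by
    refine Metric.cauchySeq_iff.2 fun ε hε => ?_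
    obtain ⟨N, hN⟩ := Metric.cauchySeq_iff.1 hlim.cauchySeq ε hε
    refine ⟨N, fun m hm n hn => ?_⟩
    have h1 := hPn _ (P.sub_mem (hb m) (hb n))
    simp only [Prod.mk_sub_mk] at h1
    rw [dist_eq_norm, h1, ← dist_eq_norm]
    exact hN m hm n hn
  obtain ⟨f', hf'⟩ := cauchySeq_tendsto_of_complete hbc
  refine ⟨f', fun x => ?_, ?_⟩
  · refine tendsto_nhds_unique (tendsto_const_nhds.inner hf') ?_
    have : ∀ n, inner ℂ (k₂ x) (b n) = inner ℂ (k₁ x) (a n) := fun n => (hP1 _ (hb n) x).symm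
    simp_rw [this]
    exact tendsto_const_nhds.inner hlim
  · refine tendsto_nhds_unique hf'.norm ?_
    have : ∀ n, ‖b n‖ = ‖a n‖ := fun n => hPn _ (hb n)
    simp_rw [this]
    exact hlim.norm

/-- The identity theorem for entire functions that agree on the upper half plane. -/
theorem eq_of_eq_on_im_pos {f g : ℂ → ℂ} (hf : Differentiable ℂ f) (hg : Differentiable ℂ g)
    (h : ∀ z : ℂ, 0 < z.im → f z = g z) (z : ℂ) : f z = g z := by
  refine congrFun ((hf.differentiableOn.analyticOnNhd isOpen_univ).eq_of_eventuallyEq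
    (hg.differentiableOn.analyticOnNhd isOpen_univ) (z₀ := Complex.I) ?_) z
  filter_upwards [isOpen_im_pos.mem_nhds (show (0 : ℝ) < Complex.I.im by simp)] with z hz
  exact h z hz

/-! ### The kernel of a nearly invariant subspace -/

namespace DeBrangesSpace

variable {E : DeBrangesFunction}

/-- Riesz representation of the point evaluations on a closed subspace of `H(E)`. -/
theorem exists_kernel (hE : ∀ x : ℝ, E x ≠ 0) (N : Submodule ℂ (DeBrangesSpace E))
    (hclosed : IsClosed (N : Set (DeBrangesSpace E))) (w : ℂ) :
    ∃ k ∈ N, ∀ f ∈ N, inner ℂ k f = f w := by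
  have := completeSpace hE
  have : CompleteSpace N := hclosed.completeSpace_coe
  obtain ⟨M, hM⟩ := exists_norm_apply_le hE ‖w‖
  set ev : N →ₗ[ℂ] ℂ :=
    { toFun := fun f => (f : DeBrangesSpace E) w
      map_add' := fun f g => rfl
      map_smul' := fun c f => rfl } with hev
  set ℓ : N →L[ℂ] ℂ := ev.mkContinuous M fun f => hM f w le_rfl with hℓ
  set k := (InnerProductSpace.toDual ℂ N).symm ℓ with hk
  refine ⟨k, k.2, fun f hf => ?_⟩
  exact InnerProductSpace.toDual_symm_apply (x := (⟨f, hf⟩ : N)) (y := ℓ)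

/-- The inner product is invariant under multiplication by a function unimodular on the line. -/
theorem inner_eq_of_mul_eq {lam : ℂ} (hlam : lam.im ≠ 0) {F f G g : DeBrangesSpace E}
    (hF : ∀ z, (z - lam) * F z = (z - conj lam) * f z)
    (hG : ∀ z, (z - lam) * G z = (z - conj lam) * g z) : inner ℂ F G = inner ℂ f g := by
  rw [inner_eq_integral, inner_eq_integral]
  refine integral_congr_ae (Filter.Eventually.of_forall fun x => ?_)
  have h1 := ofReal_sub_ne_zero hlam x
  have h2 : conj ((x : ℂ) - lam) = x - conj lam := by simp
  have h3 : (x : ℂ) - conj lam ≠ 0 := ofReal_sub_ne_zero (by simpa using hlam) x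
  have h4 : F x = (x - conj lam) * f x / (x - lam) := by
    rw [eq_div_iff h1, ← hF]; ring
  have h5 : G x = (x - conj lam) * g x / (x - lam) := by
    rw [eq_div_iff h1, ← hG]; ring
  have h6 : conj ((x : ℂ) - conj lam) = x - lam := by simp
  simp only [h4, h5, map_div₀, map_mul, h2, h6]
  field_simp

/-- `(z - μ) / (z - lam) = 1 + (lam - μ) / (z - lam)`: a zero at `lam` can be moved to `μ` inside
`N`. -/
theorem NearlyInvariant.exists_mul_eq {N : Submodule ℂ (DeBrangesSpace E)}
    (hnear : NearlyInvariant N) {lam : ℂ} (hzero : ¬ IsCommonZero N lam) (μ : ℂ)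
    {f : DeBrangesSpace E} (hf : f ∈ N) (h0 : f lam = 0) :
    ∃ F ∈ N, ∀ z, (z - lam) * F z = (z - μ) * f z := by
  obtain ⟨q, hq, hqz⟩ := hnear f hf lam hzero h0
  refine ⟨f + (lam - μ) • q, N.add_mem hf (N.smul_mem _ hq), fun z => ?_⟩
  rcases eq_or_ne z lam with rfl | hz
  · simp [h0]
  · rw [add_apply, smul_apply, hqz z hz]
    have := sub_ne_zero.2 hz
    field_simp
    ring

/-- The kernel of a nearly invariant subspace is determined by its values at two conjugate
points. -/
theorem NearlyInvariant.kernel_identity {N : Submodule ℂ (DeBrangesSpace E)}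
    (hnear : NearlyInvariant N) (hzero : ∀ z₀ : ℂ, ¬ IsCommonZero N z₀)
    {K : ℂ → DeBrangesSpace E} (hKN : ∀ w, K w ∈ N) (hK : ∀ w, ∀ f ∈ N, inner ℂ (K w) f = f w)
    {lam : ℂ} (hlam : lam.im ≠ 0) (ha : K lam lam ≠ 0) (hb : K (conj lam) (conj lam) ≠ 0)
    (w z : ℂ) :
    (lam - conj lam) * (conj w - z) * K w z =
      (z - conj lam) * K lam z * conj ((w - conj lam) * K lam w) / K lam lam -
      (z - lam) * K (conj lam) z * conj ((w - lam) * K (conj lam) w) /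
        K (conj lam) (conj lam) := by
  have hsymm : ∀ x y, K x y = conj (K y x) := fun x y => by
    rw [← hK y _ (hKN x), ← hK x _ (hKN y), inner_conj_symm]
  have hll : lam - conj lam ≠ 0 := by
    rw [Complex.sub_conj]
    simp [hlam]
  -- Here Hermitian symmetry suffices; the general argument divides by `w - conj lam`.
  rcases eq_or_ne w (conj lam) with rfl | hw
  · rw [sub_self, zero_mul, map_zero, mul_zero, zero_div, map_mul, ← hsymm, map_sub,
      Complex.conj_conj]
    field_simp
    ring
  · have hw' : w - conj lam ≠ 0 := sub_ne_zero.2 hw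
    have hw'' : conj (w - conj lam) ≠ 0 := (map_ne_zero _).2 hw'
    -- `G` reproduces at `w` the functions of `N` that vanish at `lam`; `F` is its image among those
    -- vanishing at `conj lam`.
    set G := K w - (K w lam / K lam lam) • K lam with hG
    have hGN : G ∈ N := N.sub_mem (hKN _) (N.smul_mem _ (hKN _))
    have hG0 : G lam = 0 := by
      rw [hG, sub_apply, smul_apply, div_mul_cancel₀ _ ha, sub_self]
    obtain ⟨F, hFN, hF⟩ := hnear.exists_mul_eq (hzero lam) (conj lam) hGN hG0
    -- The kernel at `w` for functions of `N` vanishing at `conj lam`, scaled as the isometry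
    -- demands. The claim reduces to `F = H`.
    set H := conj ((w - lam) / (w - conj lam)) •
      (K w - (K w (conj lam) / K (conj lam) (conj lam)) • K (conj lam)) with hH
    have hHN : H ∈ N := N.smul_mem _ (N.sub_mem (hKN _) (N.smul_mem _ (hKN _)))
    have hH0 : H (conj lam) = 0 := by
      rw [hH, smul_apply, sub_apply, smul_apply, div_mul_cancel₀ _ hb, sub_self, mul_zero]
    have hF0 : F (conj lam) = 0 := by
      have h := hF (conj lam)
      rw [sub_self, zero_mul] at h
      exact (mul_eq_zero.1 h).resolve_left fun h => hll (by linear_combination -h)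
    have hdN : F - H ∈ N := N.sub_mem hFN hHN
    have hd0 : (F - H) (conj lam) = 0 := by rw [sub_apply, hF0, hH0, sub_zero]
    obtain ⟨d, hd'N, hd⟩ := hnear.exists_mul_eq (hzero _) lam hdN hd0
    have hdl : d lam = 0 := by
      have h := hd lam
      rw [sub_self, zero_mul] at h
      exact (mul_eq_zero.1 h).resolve_left hll
    have hdw : d w = (w - lam) / (w - conj lam) * (F - H) w := by
      have := hd w
      field_simp
      linear_combination this
    have h1 : inner ℂ F (F - H) = inner ℂ G d :=
      inner_eq_of_mul_eq hlam hF fun z => (hd z).symm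
    have h2 : inner ℂ G d = d w := by
      rw [hG, inner_sub_left, inner_smul_left, hK w d hd'N, hK lam d hd'N, hdl, mul_zero, sub_zero]
    have h3 : inner ℂ H (F - H) = (w - lam) / (w - conj lam) * (F - H) w := by
      rw [hH, inner_smul_left, inner_sub_left, inner_smul_left, ← hH, hK w _ hdN, hK _ _ hdN,
        hd0, mul_zero, sub_zero, Complex.conj_conj]
    -- Pulled back by the isometry, `F - H` becomes `d`, so `F` and `H` have the same inner product
    -- with `F - H`.
    have h4 : F - H = 0 := by
      rw [← inner_self_eq_zero (𝕜 := ℂ), inner_sub_left, h1, h2, h3, hdw, sub_self]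
    have h5 := hF z
    rw [sub_eq_zero.1 h4, hH, hG, smul_apply, sub_apply, sub_apply, smul_apply, smul_apply,
      hsymm w lam, hsymm w (conj lam), map_div₀] at h5
    simp only [map_mul]
    simp only [map_sub, Complex.conj_conj] at h5 hw'' ⊢
    field_simp at h5 ⊢
    linear_combination -h5

theorem kernel_self_eq {N : Submodule ℂ (DeBrangesSpace E)} {K : ℂ → DeBrangesSpace E}
    (hKN : ∀ w, K w ∈ N) (hK : ∀ w, ∀ f ∈ N, inner ℂ (K w) f = f w) (w : ℂ) :
    K w w = (‖K w‖ ^ 2 : ℝ) := by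
  rw [← hK w _ (hKN w), inner_self_eq_norm_sq_to_K]
  push_cast
  rfl

theorem kernel_norm_pos {N : Submodule ℂ (DeBrangesSpace E)}
    (hzero : ∀ z₀ : ℂ, ¬ IsCommonZero N z₀) {K : ℂ → DeBrangesSpace E}
    (hK : ∀ w, ∀ f ∈ N, inner ℂ (K w) f = f w) (w : ℂ) : 0 < ‖K w‖ := by
  refine norm_pos_iff.2 fun h => hzero w fun f hf => ?_
  rw [← hK w f hf, h, inner_zero_left]

/-- The kernel of a nearly invariant subspace without common zeros, in factorized form. -/
theorem NearlyInvariant.exists_kernel_factorization {N : Submodule ℂ (DeBrangesSpace E)}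
    (hnear : NearlyInvariant N) (hzero : ∀ z₀ : ℂ, ¬ IsCommonZero N z₀)
    {K : ℂ → DeBrangesSpace E} (hKN : ∀ w, K w ∈ N)
    (hK : ∀ w, ∀ f ∈ N, inner ℂ (K w) f = f w) :
    ∃ u v : DeBrangesSpace E, ∀ w z, 2 * Complex.I * (conj w - z) * K w z =
      (z + Complex.I) * u z * conj ((w + Complex.I) * u w) -
      (z - Complex.I) * v z * conj ((w - Complex.I) * v w) := by
  have hself := kernel_self_eq hKN hK
  have hpos := kernel_norm_pos hzero hK
  have hne : ∀ w, K w w ≠ 0 := fun w => by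
    rw [hself]
    exact_mod_cast (pow_pos (hpos w) 2).ne'
  -- The denominators `K lam lam = ‖K lam‖²` are shared evenly between the two factors.
  refine ⟨((‖K Complex.I‖⁻¹ : ℝ) : ℂ) • K Complex.I,
    ((‖K (conj Complex.I)‖⁻¹ : ℝ) : ℂ) • K (conj Complex.I), fun w z => ?_⟩
  have h := hnear.kernel_identity hzero hKN hK (lam := Complex.I) (by simp) (hne _) (hne _) w z
  rw [hself, hself] at h
  have h1 : (‖K Complex.I‖ : ℂ) ≠ 0 := by exact_mod_cast (hpos _).ne'
  have h2 : (‖K (conj Complex.I)‖ : ℂ) ≠ 0 := by exact_mod_cast (hpos _).ne'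
  simp only [smul_apply, map_mul, Complex.conj_ofReal]
  rw [Complex.ofReal_pow, Complex.ofReal_pow, map_mul, map_mul] at h
  have h3 : Complex.I - conj Complex.I = 2 * Complex.I := by simp; ring
  have h4 : z - conj Complex.I = z + Complex.I := by simp
  have h5 : w - conj Complex.I = w + Complex.I := by simp
  rw [h3, h4, h5] at h
  rw [h]
  push_cast
  field_simp

end DeBrangesSpace

/-! ### The exponential factor and the space `H(E₀)` -/

/-- If `A A^* = B B^*`, where `A` has no zeros in the closed upper and `B` no zeros in the closed
lower half plane, then `A / B^*` extends to a zero-free entire function of modulus one on the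
real line. -/
theorem exists_entire_quotient {A B : ℂ → ℂ} (hA : Differentiable ℂ A) (hB : Differentiable ℂ B)
    (hAB : ∀ z, A z * conjReflect A z = B z * conjReflect B z)
    (hA0 : ∀ z : ℂ, 0 ≤ z.im → A z ≠ 0) (hB0 : ∀ z : ℂ, z.im ≤ 0 → B z ≠ 0) :
    ∃ θ : ℂ → ℂ, Differentiable ℂ θ ∧ (∀ z, θ z * conj (θ (conj z)) = 1) ∧
      ∀ z, A z = θ z * conjReflect B z := by
  have hAr : ∀ z : ℂ, z.im ≤ 0 → conjReflect A z ≠ 0 := fun z hz =>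
    (map_ne_zero _).2 (hA0 _ (by simpa using hz))
  have hBr : ∀ z : ℂ, 0 ≤ z.im → conjReflect B z ≠ 0 := fun z hz =>
    (map_ne_zero _).2 (hB0 _ (by simpa using hz))
  classical
  -- The two quotients agree wherever both are defined, and each has a nonvanishing denominator on
  -- its closed half plane.
  set θ : ℂ → ℂ := fun z => if 0 ≤ z.im then A z / conjReflect B z else B z / conjReflect A z
    with hθ
  have h1 : ∀ z, conjReflect B z ≠ 0 → θ z = A z / conjReflect B z := by
    intro z hz
    by_cases h : 0 ≤ z.im
    · simp only [hθ, if_pos h]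
    · simp only [hθ, if_neg h]
      rw [div_eq_div_iff (hAr z (not_le.1 h).le) hz, hAB]
  have h2 : ∀ z, conjReflect A z ≠ 0 → θ z = B z / conjReflect A z := by
    intro z hz
    by_cases h : 0 ≤ z.im
    · simp only [hθ, if_pos h]
      rw [div_eq_div_iff (hBr z h) hz, hAB]
    · simp only [hθ, if_neg h]
  refine ⟨θ, fun z => ?_, fun z => ?_, fun z => ?_⟩
  · rcases le_total 0 z.im with h | h
    · refine ((hA z).div (hB.conjReflect z) (hBr z h)).congr_of_eventuallyEq ?_
      filter_upwards [hB.conjReflect.continuous.continuousAt.eventually_ne (hBr z h)] with x hx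
      exact h1 x hx
    · refine ((hB z).div (hA.conjReflect z) (hAr z h)).congr_of_eventuallyEq ?_
      filter_upwards [hA.conjReflect.continuous.continuousAt.eventually_ne (hAr z h)] with x hx
      exact h2 x hx
  · rcases le_total 0 z.im with h | h
    · have hz : (conj z).im ≤ 0 := by simpa using h
      rw [h1 z (hBr z h), h2 _ (hAr _ hz), map_div₀]
      have h3 := hA0 z h
      have h4 := hBr z h
      simp only [conjReflect_apply, Complex.conj_conj] at h4 ⊢
      field_simp
    · have hz : 0 ≤ (conj z).im := by simpa using h
      rw [h2 z (hAr z h), h1 _ (hBr _ hz), map_div₀]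
      have h3 := hB0 z h
      have h4 := hAr z h
      simp only [conjReflect_apply, Complex.conj_conj] at h4 ⊢
      field_simp
  · by_cases h : conjReflect B z = 0
    · have h3 : conjReflect A z ≠ 0 := hAr z (not_lt.1 fun hlt => hBr z hlt.le h)
      have h4 := hAB z
      rw [h, mul_zero] at h4
      rw [h, mul_zero]
      exact (mul_eq_zero.1 h4).resolve_right h3
    · rw [h1 z h, div_mul_cancel₀ _ h]

namespace DeBrangesSpace

variable {E : DeBrangesFunction}

/-- After division by an exponential, the kernel of a nearly invariant subspace without common
zeros is the kernel of a de Branges space. -/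
theorem NearlyInvariant.exists_isKernelAt {N : Submodule ℂ (DeBrangesSpace E)}
    (hnear : NearlyInvariant N) (hzero : ∀ z₀ : ℂ, ¬ IsCommonZero N z₀)
    {K : ℂ → DeBrangesSpace E} (hKN : ∀ w, K w ∈ N)
    (hK : ∀ w, ∀ f ∈ N, inner ℂ (K w) f = f w) :
    ∃ (α : ℝ) (E₀ : DeBrangesFunction), (∀ x : ℝ, E₀ x ≠ 0) ∧ ∀ w, E₀.IsKernelAt w fun z =>
      Complex.exp (-(Complex.I * α * z)) * conj (Complex.exp (-(Complex.I * α * w))) * K w z := by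
  obtain ⟨u, v, huv⟩ := hnear.exists_kernel_factorization hzero hKN hK
  have hpos := kernel_norm_pos hzero hK
  set A : ℂ → ℂ := fun z => (z + Complex.I) * u z with hAdef
  set B : ℂ → ℂ := fun z => (z - Complex.I) * v z with hBdef
  have hud : Differentiable ℂ u := u.mem.entire
  have hvd : Differentiable ℂ v := v.mem.entire
  have hA : Differentiable ℂ A := by fun_prop
  have hB : Differentiable ℂ B := by fun_prop
  have hid : ∀ w z, 2 * Complex.I * (conj w - z) * K w z = A z * conj (A w) - B z * conj (B w) :=
    huv
  have hdiag : ∀ z : ℂ, ‖A z‖ ^ 2 = ‖B z‖ ^ 2 + 4 * z.im * ‖K z‖ ^ 2 := by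
    intro z
    have h := hid z z
    have h3 : conj z - z = -(2 * z.im * Complex.I) := by
      rw [← neg_sub, Complex.sub_conj]; push_cast; ring
    rw [kernel_self_eq hKN hK, Complex.mul_conj', Complex.mul_conj', h3] at h
    have h4 : (‖A z‖ ^ 2 : ℂ) = (‖B z‖ ^ 2 + 4 * z.im * ‖K z‖ ^ 2 : ℂ) := by
      push_cast at h
      linear_combination -h - 4 * z.im * ‖K z‖ ^ 2 * Complex.I_sq
    exact_mod_cast h4
  have hAB : ∀ z, A z * conjReflect A z = B z * conjReflect B z := by
    intro z
    have h := hid (conj z) z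
    rw [Complex.conj_conj, sub_self, mul_zero, zero_mul] at h
    exact (sub_eq_zero.1 h.symm)
  -- At a real zero of `A` also `B` vanishes, and then the factorization forces the whole function
  -- `K x` to vanish.
  have hreal : ∀ z : ℂ, z.im = 0 → A z ≠ 0 := by
    intro x hx h0
    have h1 := hdiag x
    rw [hx, h0, norm_zero] at h1
    have hB0 : B x = 0 := by
      have : ‖B x‖ = 0 := by simpa using h1.symm
      exact norm_eq_zero.1 this
    have h2 : (K x : ℂ → ℂ) = fun _ => 0 := by
      refine Continuous.ext_on (dense_compl_singleton x) (K x).mem.entire.continuous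
        continuous_const fun z hz => ?_
      have h3 := hid x z
      rw [h0, hB0, map_zero, mul_zero, mul_zero, sub_zero, Complex.conj_eq_iff_im.2 hx] at h3
      refine (mul_eq_zero.1 h3).resolve_left (mul_ne_zero (by simp) ?_)
      exact sub_ne_zero.2 (Ne.symm hz)
    have h3 := kernel_self_eq hKN hK x
    rw [congrFun h2 x] at h3
    have h4 : ‖K x‖ ^ 2 = 0 := by exact_mod_cast h3.symm
    exact (pow_pos (hpos x) 2).ne' h4
  have hlt : ∀ z : ℂ, 0 < z.im → ‖B z‖ < ‖A z‖ := by
    intro z hz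
    refine lt_of_pow_lt_pow_left₀ 2 (norm_nonneg _) ?_
    rw [hdiag]
    linarith [mul_pos (mul_pos four_pos hz) (pow_pos (hpos z) 2)]
  have hA0 : ∀ z : ℂ, 0 ≤ z.im → A z ≠ 0 := by
    intro z hz
    rcases hz.lt_or_eq with h | h
    · exact norm_pos_iff.1 ((norm_nonneg _).trans_lt (hlt z h))
    · exact hreal z h.symm
  have hB0 : ∀ z : ℂ, z.im ≤ 0 → B z ≠ 0 := by
    intro z hz h0
    have h1 := hdiag z
    rw [h0, norm_zero] at h1
    rcases hz.lt_or_eq with h | h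
    · have h2 := mul_pos (mul_pos four_pos (neg_pos.2 h)) (pow_pos (hpos z) 2)
      nlinarith [sq_nonneg ‖A z‖]
    · rw [h] at h1
      exact hreal z h (by simpa using h1)
  obtain ⟨θ, hθd, hθs, hθ⟩ := exists_entire_quotient hA hB hAB hA0 hB0
  obtain ⟨C₁, -, hC₁⟩ := u.mem.hardy.exists_norm_le
  obtain ⟨C₂, -, hC₂⟩ := v.mem.hardy_conj.exists_norm_le
  have hBr : ∀ z, conjReflect B z = (z + Complex.I) * conjReflect v z := by
    intro z
    simp [conjReflect_apply, hBdef]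
  have hzI : ∀ z : ℂ, 0 < z.im → z + Complex.I ≠ 0 := fun z hz h => by
    have := congrArg Complex.im h
    simp at this
    linarith
  -- The factor `z + i` is common to `A` and `B^*`, so `θ` is a quotient of Hardy functions.
  obtain ⟨α, c, hc, hexp⟩ := exists_eq_mul_exp (g₁ := fun z => u z / E z)
    (g₂ := fun z => conjReflect v z / E z) hθd hθs u.mem.hardy.1 v.mem.hardy_conj.1
    (fun z hz => div_ne_zero (right_ne_zero_of_mul (hA0 z hz.le)) (E.ne_zero_of_im_pos hz))
    (fun z hz => by
      refine div_ne_zero ?_ (E.ne_zero_of_im_pos hz)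
      have h : conjReflect B z ≠ 0 :=
        (map_ne_zero _).2 (hB0 (conj z) (by simpa using hz.le))
      rw [hBr] at h
      exact right_ne_zero_of_mul h)
    hC₁ hC₂ (fun z hz => by
      rw [← mul_div_assoc]
      congr 1
      have h := hθ z
      rw [hBr] at h
      refine mul_left_cancel₀ (hzI z hz) ?_
      linear_combination -h)
  have hcc : conj c * c = 1 := by rw [Complex.conj_mul', hc]; simp
  have hAr : ∀ z, conjReflect A z = conj c * Complex.exp (-(2 * Complex.I * α * z)) * B z := by
    intro z
    have h2 : conj (2 : ℂ) = 2 := map_ofNat _ 2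
    rw [conjReflect_apply, hθ, hexp]
    simp [conjReflect_apply, ← Complex.exp_conj, h2]
  -- `s² = π` accounts for `2πi` in the kernel formula against `2i` in the factorization.
  set s : ℂ := ((Real.sqrt Real.pi : ℝ) : ℂ) with hs
  have hss : s * s = Real.pi := by
    rw [hs, ← Complex.ofReal_mul, Real.mul_self_sqrt Real.pi_pos.le]
  have hs0 : s ≠ 0 := fun h => by
    rw [h, mul_zero] at hss
    exact Real.pi_ne_zero (by exact_mod_cast hss.symm)
  -- Half of the exponent of `θ` goes here, so that `F^*` is `B` times the same factor, up to the
  -- unimodular constant `conj c`.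
  set F : ℂ → ℂ := fun z => s * Complex.exp (-(Complex.I * α * z)) * A z with hF
  have hFr : ∀ z, conjReflect F z = s * conj c * Complex.exp (-(Complex.I * α * z)) * B z := by
    intro z
    have h1 : conjReflect F z = s * Complex.exp (Complex.I * α * z) * conjReflect A z := by
      simp [conjReflect_apply, hF, hs, ← Complex.exp_conj]
    rw [h1, hAr]
    have h2 : Complex.exp (-(Complex.I * α * z)) =
        Complex.exp (Complex.I * α * z) * Complex.exp (-(2 * Complex.I * α * z)) := by
      rw [← Complex.exp_add]; congr 1; ring
    rw [h2]; ring
  have hFd : Differentiable ℂ F := by fun_prop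
  refine ⟨α, ⟨F, hFd, fun z hz => ?_⟩, fun x => ?_, fun w => ⟨?_, fun z => ?_⟩⟩
  · have h1 : ‖F (conj z)‖ = ‖conjReflect F z‖ := by
      rw [conjReflect_apply, Complex.norm_conj]
    rw [h1, hFr, hF]
    simp only [norm_mul, Complex.norm_conj, hc, mul_one]
    refine mul_lt_mul_of_pos_left (hlt z hz) ?_
    exact mul_pos (norm_pos_iff.2 hs0) (norm_pos_iff.2 (Complex.exp_ne_zero _))
  · exact mul_ne_zero (mul_ne_zero hs0 (Complex.exp_ne_zero _)) (hA0 x (by simp))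
  · have : Differentiable ℂ (K w) := (K w).mem.entire
    fun_prop
  · change _ = F z * conj (F w) - conjReflect F z * conj (conjReflect F w)
    rw [hFr, hFr]
    have h1 := hid w z
    have hsc : conj s = s := Complex.conj_ofReal _
    simp only [hF, map_mul, Complex.conj_conj, hsc]
    generalize conj (Complex.exp (-(Complex.I * α * w))) = e
    generalize Complex.exp (-(Complex.I * α * z)) = e'
    linear_combination Real.pi * e * e' * h1 - (e * e' * A z * conj (A w)
      - e * e' * B z * conj (B w)) * hss + s * s * e * e' * B z * conj (B w) * hcc

/-- A closed nearly invariant subspace without common zeros consists of exactly the products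
`e^{iαz} f` with `f` in some de Branges space, isometrically. -/
theorem NearlyInvariant.exists_isometry {N : Submodule ℂ (DeBrangesSpace E)}
    (hclosed : IsClosed (N : Set (DeBrangesSpace E))) (hnear : NearlyInvariant N)
    (hzero : ∀ z₀ : ℂ, ¬ IsCommonZero N z₀) :
    ∃ (α : ℝ) (E₀ : DeBrangesFunction),
      (∀ h ∈ N, ∃ f : DeBrangesSpace E₀,
        (∀ z, h z = Complex.exp (Complex.I * α * z) * f z) ∧ ‖f‖ = ‖h‖) ∧
      ∀ f : DeBrangesSpace E₀, ∃ h ∈ N, ∀ z, h z = Complex.exp (Complex.I * α * z) * f z := by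
  -- A real zero of `E` would be a common zero of all of `H(E)`.
  have hE : ∀ x : ℝ, E x ≠ 0 := fun x hx =>
    hzero x fun f _ => f.mem.eq_zero_of_eq_zero hx
  choose K hKN hK using exists_kernel hE N hclosed
  obtain ⟨α, E₀, hE₀, hker⟩ := hnear.exists_isKernelAt hzero hKN hK
  refine ⟨α, E₀, ?_⟩
  have := completeSpace hE
  have : CompleteSpace N := hclosed.completeSpace_coe
  have := completeSpace hE₀
  set e : ℂ → ℂ := fun z => Complex.exp (-(Complex.I * α * z)) with he
  have he0 : ∀ z, e z ≠ 0 := fun z => Complex.exp_ne_zero _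
  have hee : ∀ z a b, e z * a = b → a = Complex.exp (Complex.I * α * z) * b := by
    intro z a b h
    rw [← h, ← mul_assoc, he, ← Complex.exp_add]
    simp
  have hed : Differentiable ℂ e := by fun_prop
  -- Points of the upper half plane suffice: the kernels there are total by the identity theorem.
  set k₁ : {w : ℂ // 0 < w.im} → N := fun w => conj (e w) • ⟨K w, hKN w⟩ with hk₁
  set k₂ : {w : ℂ // 0 < w.im} → DeBrangesSpace E₀ :=
    fun w => ofMem ((hker w).memDeBranges hE₀ w.2) with hk₂
  have hin₁ : ∀ w (f : N), inner ℂ (k₁ w) f = e w * (f : DeBrangesSpace E) w := by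
    intro w f
    change inner ℂ (conj (e w) • K w) (f : DeBrangesSpace E) = _
    rw [inner_smul_left, Complex.conj_conj, hK w f f.2]
  have hin₂ : ∀ w f, inner ℂ (k₂ w) f = f w := fun w f =>
    inner_kernel hE₀ w.2 _ f (hker w)
  have hgram : ∀ x y, inner ℂ (k₁ x) (k₁ y) = inner ℂ (k₂ x) (k₂ y) := by
    intro x y
    rw [hin₁, hin₂, hk₂, ofMem_apply, mul_assoc]
    rfl
  have htot₁ : ∀ f : N, (∀ w, inner ℂ (k₁ w) f = 0) → f = 0 := by
    intro f hf
    refine Subtype.ext (DeBrangesSpace.ext fun z => ?_)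
    refine eq_of_eq_on_im_pos (g := fun _ => 0) (f : DeBrangesSpace E).mem.entire
      (differentiable_const _) (fun w hw => ?_) z
    have h := hf ⟨w, hw⟩
    rw [hin₁] at h
    exact (mul_eq_zero.1 h).resolve_left (he0 w)
  have htot₂ : ∀ f : DeBrangesSpace E₀, (∀ w, inner ℂ (k₂ w) f = 0) → f = 0 := by
    intro f hf
    refine DeBrangesSpace.ext fun z => ?_
    refine eq_of_eq_on_im_pos (g := fun _ => 0) f.mem.entire
      (differentiable_const _) (fun w hw => ?_) z
    rw [← hin₂ ⟨w, hw⟩, hf]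
  refine ⟨fun h hh => ?_, fun f => ?_⟩
  · obtain ⟨f, hf, hn⟩ := exists_of_inner_eq k₁ k₂ hgram htot₁ ⟨h, hh⟩
    refine ⟨f, fun z => hee z _ _ ?_, hn⟩
    refine eq_of_eq_on_im_pos (f := fun z => e z * h z) (hed.mul h.mem.entire) f.mem.entire
      (fun w hw => ?_) z
    have := hf ⟨w, hw⟩
    rw [hin₁, hin₂] at this
    exact this.symm
  · obtain ⟨h, hh, -⟩ := exists_of_inner_eq k₂ k₁ (fun x y => (hgram x y).symm) htot₂ f
    refine ⟨h, h.2, fun z => hee z _ _ ?_⟩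
    refine eq_of_eq_on_im_pos (f := fun z => e z * (h : DeBrangesSpace E) z)
      (hed.mul (h : DeBrangesSpace E).mem.entire) f.mem.entire (fun w hw => ?_) z
    have := hh ⟨w, hw⟩
    rw [hin₁, hin₂] at this
    exact this

end DeBrangesSpace

theorem theorem1 (E : DeBrangesFunction) (N : Submodule ℂ (DeBrangesSpace E))
    (hclosed : IsClosed (N : Set (DeBrangesSpace E)))
    (hnear : DeBrangesSpace.NearlyInvariant N)
    (hzero : ∀ z₀ : ℂ, ¬ DeBrangesSpace.IsCommonZero N z₀) :
    ∃ (α : ℝ) (E₀ : DeBrangesFunction),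
      {g : ℂ → ℂ | ∃ h ∈ N, ∀ z, g z = h z} =
        {g : ℂ → ℂ | ∃ f : DeBrangesSpace E₀, ∀ z, g z = Complex.exp (Complex.I * α * z) * f z} ∧
      ∀ (h : DeBrangesSpace E) (f : DeBrangesSpace E₀), h ∈ N →
        (∀ z, h z = Complex.exp (Complex.I * α * z) * f z) → ‖h‖ = ‖f‖ := by
  obtain ⟨α, E₀, h₁, h₂⟩ := hnear.exists_isometry hclosed hzero
  refine ⟨α, E₀, Set.ext fun g => ⟨?_, ?_⟩, fun h f hh hf => ?_⟩
  · rintro ⟨h, hh, hg⟩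
    obtain ⟨f, hf, -⟩ := h₁ h hh
    exact ⟨f, fun z => (hg z).trans (hf z)⟩
  · rintro ⟨f, hf⟩
    obtain ⟨h, hh, hg⟩ := h₂ f
    exact ⟨h, hh, fun z => (hf z).trans (hg z).symm⟩
  · obtain ⟨f', hf', hn⟩ := h₁ h hh
    have : f' = f := DeBrangesSpace.ext fun z =>
      mul_left_cancel₀ (Complex.exp_ne_zero _) ((hf' z).symm.trans (hf z))
    rw [← hn, this]
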